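/- For $d \mid n$ let $\pi_{n,d} : \mathrm{GL}_2(\mathbb{Z}/n\mathbb{Z}) \to \mathrm{GL}_2(\mathbb{Z}/d\mathbb{Z})$ denote the reduction map. Let $\varepsilon : \mathrm{GL}_2(\mathbb{Z}/2\mathbb{Z}) \to \{\pm 1\}$ be the unique nontrivial character, and identify $(\mathbb{Z}/4\mathbb{Z})^\times$ with $\{\pm 1\}$. Let $$\mathcal{N} = \left\{ \begin{pmatrix} x & -y \\ y & x \end{pmatrix} : x^2 + y^2 = 1 \right\} \sqcup \left\{ \begin{pmatrix} x & y \\ y & -x \end{pmatrix} : x^2 + y^2 = -1 \right\} \subseteq \mathrm{GL}_2(\mathbb{Z}/3\mathbb{Z}),$$ a normal subgroup of index $6$, and let $\theta : \mathrm{GL}_2(\mathbb{Z}/3\mathbb{Z}) \to \mathrm{GL}_2(\mathbb{Z}/2\mathbb{Z})$ be any surjective homomorphism with kernel $\mathcal{N}$ (such homomorphisms exist). Define $$H_4' = \{ g \in \mathrm{GL}_2(\mathbb{Z}/4\mathbb{Z}) : \det g = \varepsilon(g \bmod 2) \}, \qquad H_4'' = \left\langle \begin{pmatrix} 0 & 1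 \\ 3 & 0 \end{pmatrix}, \begin{pmatrix} 0 & 1 \\ 1 & 1 \end{pmatrix} \right\rangle \subseteq \mathrm{GL}_2(\mathbb{Z}/4\mathbb{Z}),$$ $$H_9' = \left\langle \begin{pmatrix} 0 & 4 \\ 2 & 0 \end{pmatrix}, \begin{pmatrix} 4 & 1 \\ -3 & 4 \end{pmatrix}, \begin{pmatrix} 2 & 0 \\ 0 & 2 \end{pmatrix}, \begin{pmatrix} -1 & 0 \\ 0 & 1 \end{pmatrix} \right\rangle \subseteq \mathrm{GL}_2(\mathbb{Z}/9\mathbb{Z}),$$ $$H_6' = \{ g \in \mathrm{GL}_2(\mathbb{Z}/6\mathbb{Z}) : \pi_{6,2}(g) = \theta(\pi_{6,3}(g)) \}.$$ Let $\mathcal{G}_{36}$ be the set of subgroups $H \subseteq \mathrm{GL}_2(\mathbb{Z}/36\mathbb{Z})$ such that $\pi_{36,d}(H) = \mathrm{GL}_2(\mathbb{Z}/d\mathbb{Z})$ for $d = 2, 3$, $\det(H) = (\mathbb{Z}/36\mathbb{Z})^\times$, and $[H,H] \subsetneq [\mathrm{GL}_2(\mathbb{Z}/36\mathbb{Z}),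 \mathrm{GL}_2(\mathbb{Z}/36\mathbb{Z})]$. Let $\mathcal{G}_{36,\max}$ be the set of those $H \in \mathcal{G}_{36}$ for which there is no $H_1 \in \mathcal{G}_{36}$ with $H \subsetneq H_1 \subsetneq \mathrm{GL}_2(\mathbb{Z}/36\mathbb{Z})$. Then the four subgroups $$\pi_{36,4}^{-1}(H_4'), \quad \pi_{36,4}^{-1}(H_4''), \quad \pi_{36,9}^{-1}(H_9'), \quad \pi_{36,6}^{-1}(H_6')$$ are pairwise distinct, and they form a set of representatives of $\mathcal{G}_{36,\max}$ modulo conjugation by $\mathrm{GL}_2(\mathbb{Z}/36\mathbb{Z})$: each of them lies in $\mathcal{G}_{36,\max}$, and every $H \in \mathcal{G}_{36,\max}$ is conjugate to exactly one of them. -/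

import Mathlib

/-! ### Reduction maps and the sign character -/

/-- `Gl n` is the group `GL₂(ℤ/nℤ)`. -/
abbrev Gl (n : ℕ) : Type := Matrix.GeneralLinearGroup (Fin 2) (ZMod n)

/-- For `d ∣ n`, the canonical projection `GL₂(ℤ/nℤ) → GL₂(ℤ/dℤ)`, reducing the entries mod `d`. -/
def redGl {n d : ℕ} (h : d ∣ n) : Gl n →* Gl d :=
  Matrix.GeneralLinearGroup.map (ZMod.castHom h (ZMod d))

theorem gl_two_decide (P : Matrix (Fin 2) (Fin 2) (ZMod 2) → Prop) [DecidablePred P]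
    (h : ∀ a b c d : ZMod 2, a * d - b * c ≠ 0 → P !![a, b; c, d]) (g : Gl 2) : P g.1 := by
  have h1 : (g.1).det ≠ 0 := by
    have := (Matrix.isUnit_iff_isUnit_det g.1).1 g.isUnit
    exact this.ne_zero
  have h2 := Matrix.eta_fin_two g.1
  rw [h2] at h1 ⊢
  rw [Matrix.det_fin_two_of] at h1
  exact h _ _ _ _ h1

theorem epsilonGl_mul_aux : ∀ a b c d : ZMod 2, a * d - b * c ≠ 0 →
    ∀ a' b' c' d' : ZMod 2, a' * d' - b' * c' ≠ 0 →
    (if !![a, b; c, d] * !![a', b'; c', d'] ≠ 1 ∧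
        (!![a, b; c, d] * !![a', b'; c', d']) * (!![a, b; c, d] * !![a', b'; c', d']) = 1
      then (-1 : ℤˣ) else 1) =
    (if !![a, b; c, d] ≠ 1 ∧ !![a, b; c, d] * !![a, b; c, d] = 1 then (-1 : ℤˣ) else 1) *
    (if !![a', b'; c', d'] ≠ 1 ∧ !![a', b'; c', d'] * !![a', b'; c', d'] = 1
      then (-1 : ℤˣ) else 1) := by
  decide +kernel

/-- The character `ε : GL₂(ℤ/2ℤ) → {±1}`: it takes the value `-1` exactly at the elements of
order two. It is the unique nontrivial such character, see `existsUnique_epsilonGl`. -/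
def epsilonGl : Gl 2 →* ℤˣ where
  toFun g := if g.1 ≠ 1 ∧ g.1 * g.1 = 1 then -1 else 1
  map_one' := by simp
  map_mul' g g' := by
    have := gl_two_decide (fun m => ∀ a' b' c' d' : ZMod 2, a' * d' - b' * c' ≠ 0 →
      (if m * !![a', b'; c', d'] ≠ 1 ∧
          (m * !![a', b'; c', d']) * (m * !![a', b'; c', d']) = 1 then (-1 : ℤˣ) else 1) =
      (if m ≠ 1 ∧ m * m = 1 then (-1 : ℤˣ) else 1) *
      (if !![a', b'; c', d'] ≠ 1 ∧ !![a', b'; c', d'] * !![a', b'; c', d'] = 1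
        then (-1 : ℤˣ) else 1)) epsilonGl_mul_aux g
    exact gl_two_decide (fun m' => (if g.1 * m' ≠ 1 ∧ (g.1 * m') * (g.1 * m') = 1
      then (-1 : ℤˣ) else 1) = (if g.1 ≠ 1 ∧ g.1 * g.1 = 1 then (-1 : ℤˣ) else 1) *
      (if m' ≠ 1 ∧ m' * m' = 1 then (-1 : ℤˣ) else 1)) this g'

theorem existsUnique_epsilonGl : epsilonGl ≠ 1 ∧ ∀ χ : Gl 2 →* ℤˣ, χ ≠ 1 → χ = epsilonGl := by
  let s : Gl 2 := ⟨!![0, 1; 1, 0], !![0, 1; 1, 0], by decide, by decide⟩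
  let t : Gl 2 := ⟨!![1, 1; 0, 1], !![1, 1; 0, 1], by decide, by decide⟩
  have hs : epsilonGl s = -1 := by decide
  have ht : epsilonGl t = -1 := by decide
  have hgen : ∀ g : Gl 2, g = 1 ∨ g = s ∨ g = t ∨ g = s * t ∨ g = t * s ∨ g = s * (t * s) := by
    intro g
    have := gl_two_decide (fun m => m = 1 ∨ m = s.1 ∨ m = t.1 ∨ m = s.1 * t.1 ∨
      m = t.1 * s.1 ∨ m = s.1 * (t.1 * s.1)) (by decide +kernel) g
    simpa only [Units.ext_iff, Units.val_mul, Units.val_one] using this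
  refine ⟨fun h => ?_, fun χ hχ => ?_⟩
  · rw [h] at hs
    exact absurd hs (by decide)
  · have hst : s * (t * s) = t * (s * t) := by
      apply Units.ext
      decide +kernel
    have h1 : χ s = χ t := by
      have := congrArg χ hst
      simp only [map_mul] at this
      rcases Int.units_eq_one_or (χ s) with h | h <;>
        rcases Int.units_eq_one_or (χ t) with h' | h' <;> simp_all
    have h2 : χ t = -1 := by
      rcases Int.units_eq_one_or (χ t) with h | h
      · exfalso
        apply hχ
        ext g : 1
        rcases hgen g with rfl | rfl | rfl | rfl | rfl | rfl <;> simp [h1, h]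
      · exact h
    ext g : 1
    rcases hgen g with rfl | rfl | rfl | rfl | rfl | rfl <;> simp [h1, h2, hs, ht]

/-! ### The subgroups of level 4, 9 and 6 -/

/-- `H₄' = {g : det g = ε(g mod 2)}`; the values `±1` of `ε` are read in `(ℤ/4ℤ)ˣ = {±1}`. -/
def H4a : Subgroup (Gl 4) :=
  MonoidHom.eqLocus (Matrix.GeneralLinearGroup.det : Gl 4 →* (ZMod 4)ˣ)
    (((Units.map (Int.castRingHom (ZMod 4)).toMonoidHom).comp epsilonGl).comp
      (redGl (by decide : 2 ∣ 4)))

/-- `H₄''`, generated by two explicit matrices (each unit lists a matrix and its inverse). -/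
def H4b : Subgroup (Gl 4) :=
  Subgroup.closure
    { ⟨!![0, 1; 3, 0], !![0, 3; 1, 0], by decide, by decide⟩,
      ⟨!![0, 1; 1, 1], !![3, 1; 1, 0], by decide, by decide⟩ }

/-- `H₉'`, generated by four explicit matrices (each unit lists a matrix and its inverse). -/
def H9a : Subgroup (Gl 9) :=
  Subgroup.closure
    { ⟨!![0, 4; 2, 0], !![0, 5; 7, 0], by decide, by decide⟩,
      ⟨!![4, 1; -3, 4], !![4, -1; 3, 4], by decide, by decide⟩,
      ⟨!![2, 0; 0, 2], !![5, 0; 0, 5], by decide, by decide⟩,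
      ⟨!![-1, 0; 0, 1], !![-1, 0; 0, 1], by decide, by decide⟩ }

/-- The underlying set of the normal subgroup `𝒩` of index six of `GL₂(ℤ/3ℤ)`. -/
def calN : Set (Gl 3) :=
  {g | ∃ x y : ZMod 3, x ^ 2 + y ^ 2 = 1 ∧ g.1 = !![x, -y; y, x]} ∪
  {g | ∃ x y : ZMod 3, x ^ 2 + y ^ 2 = -1 ∧ g.1 = !![x, y; y, -x]}

/-- `θ` is the surjection in an exact sequence `1 → 𝒩 → GL₂(ℤ/3ℤ) → GL₂(ℤ/2ℤ) → 1`. -/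
def IsTheta (θ : Gl 3 →* Gl 2) : Prop :=
  Function.Surjective θ ∧ (θ.ker : Set (Gl 3)) = calN

/-- `H₆' = {(g₂, g₃) : g₂ = θ(g₃)}`, where `g₂`, `g₃` are the reductions of `g ∈ GL₂(ℤ/6ℤ)`
modulo `2` and modulo `3`. -/
def H6a (θ : Gl 3 →* Gl 2) : Subgroup (Gl 6) :=
  MonoidHom.eqLocus (redGl (by decide : 2 ∣ 6)) (θ.comp (redGl (by decide : 3 ∣ 6)))

/-! ### The family of subgroups of level 36 -/

/-- The subgroups `H` of `GL₂(ℤ/36ℤ)` that surject onto `GL₂(ℤ/2ℤ)` and `GL₂(ℤ/3ℤ)`, have full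
determinant, and satisfy `[H, H] ⊊ [GL₂(ℤ/36ℤ), GL₂(ℤ/36ℤ)]`. -/
def G36 : Set (Subgroup (Gl 36)) :=
  {H | H.map (redGl (by decide : 2 ∣ 36)) = ⊤ ∧
    H.map (redGl (by decide : 3 ∣ 36)) = ⊤ ∧
    H.map (Matrix.GeneralLinearGroup.det : Gl 36 →* (ZMod 36)ˣ) = ⊤ ∧
    ⁅H, H⁆ < ⁅(⊤ : Subgroup (Gl 36)), (⊤ : Subgroup (Gl 36))⁆}

/-- The maximal members of `G36`. -/
def G36max : Set (Subgroup (Gl 36)) :=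
  {H | H ∈ G36 ∧ ¬ ∃ H₁ ∈ G36, H < H₁ ∧ H₁ < ⊤}

/-- `K` is the conjugate `g H g⁻¹` of `H` by some `g`. -/
def AreConj {G : Type*} [Group G] (H K : Subgroup G) : Prop :=
  ∃ g : G, K = H.map (MulAut.conj g).toMonoidHom

/-- `R` is a set of representatives of the family `S` of subgroups modulo conjugation. -/
def IsConjRepresentatives {G : Type*} [Group G] (R S : Set (Subgroup G)) : Prop :=
  R ⊆ S ∧ ∀ H ∈ S, ∃! K, K ∈ R ∧ AreConj H K

/-! ### Existence of `θ` -/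

/-- The class in `Q₈/{±1} ≅ (ℤ/2ℤ)²` of the trace zero matrix `±i`, `±j` or `±k` with first row
`(p, q)`, where `i = (0, -1; 1, 0)`, `j = (1, 1; 1, -1)` and `k = ij`. -/
def quatClass (p q : ZMod 3) : ZMod 2 × ZMod 2 :=
  (if p * q = 1 then 0 else 1, if p = 0 then 0 else 1)

/-- The entries of the matrix of the conjugation action of `g = (a, b; c, d)` on `Q₈/{±1}`, in
the basis given by the classes of `i` and `j`. -/
def thetaEntries (a b c d : ZMod 3) : ZMod 2 × ZMod 2 × ZMod 2 × ZMod 2 :=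
  let u := quatClass (b * d + a * c) (-(a * a + b * b))
  let v := quatClass ((a + b) * d - (a - b) * c) (a * a + a * b - b * b)
  (u.1, v.1, u.2, v.2)

/-- The matrix with the entries `thetaEntries`. -/
def thetaMat (g : Matrix (Fin 2) (Fin 2) (ZMod 3)) : Matrix (Fin 2) (Fin 2) (ZMod 2) :=
  let e := thetaEntries (g 0 0) (g 0 1) (g 1 0) (g 1 1)
  !![e.1, e.2.1; e.2.2.1, e.2.2.2]

theorem gl_three_decide (P : Matrix (Fin 2) (Fin 2) (ZMod 3) → Prop)
    (h : ∀ a b c d : ZMod 3, a * d - b * c ≠ 0 → P !![a, b; c, d]) (g : Gl 3) : P g.1 := by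
  have h1 : (g.1).det ≠ 0 := ((Matrix.isUnit_iff_isUnit_det g.1).1 g.isUnit).ne_zero
  have h2 := Matrix.eta_fin_two g.1
  rw [h2] at h1 ⊢
  rw [Matrix.det_fin_two_of] at h1
  exact h _ _ _ _ h1

theorem thetaEntries_mul_aux : ∀ a b c d : ZMod 3, a * d - b * c ≠ 0 →
    ∀ a' b' c' d' : ZMod 3, a' * d' - b' * c' ≠ 0 →
    (thetaEntries (a * a' + b * c') (a * b' + b * d') (c * a' + d * c') (c * b' + d * d')) =
      ((thetaEntries a b c d).1 * (thetaEntries a' b' c' d').1 +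
          (thetaEntries a b c d).2.1 * (thetaEntries a' b' c' d').2.2.1,
        (thetaEntries a b c d).1 * (thetaEntries a' b' c' d').2.1 +
          (thetaEntries a b c d).2.1 * (thetaEntries a' b' c' d').2.2.2,
        (thetaEntries a b c d).2.2.1 * (thetaEntries a' b' c' d').1 +
          (thetaEntries a b c d).2.2.2 * (thetaEntries a' b' c' d').2.2.1,
        (thetaEntries a b c d).2.2.1 * (thetaEntries a' b' c' d').2.1 +
          (thetaEntries a b c d).2.2.2 * (thetaEntries a' b' c' d').2.2.2) := by
  decide +kernel

theorem thetaMat_mul (g g' : Gl 3) : thetaMat (g.1 * g'.1) = thetaMat g.1 * thetaMat g'.1 := by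
  refine gl_three_decide (fun m => thetaMat (m * g'.1) = thetaMat m * thetaMat g'.1) ?_ g
  intro a b c d h
  refine gl_three_decide (fun m => thetaMat (!![a, b; c, d] * m) =
    thetaMat !![a, b; c, d] * thetaMat m) ?_ g'
  intro a' b' c' d' h'
  have e := thetaEntries_mul_aux a b c d h a' b' c' d' h'
  rw [Matrix.mul_fin_two]
  simp only [thetaMat, Matrix.of_apply, Matrix.cons_val', Matrix.cons_val_zero,
    Matrix.cons_val_one, Matrix.cons_val_fin_one, e, Matrix.mul_fin_two]

theorem thetaMat_one : thetaMat 1 = 1 := by decide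

/-- A choice of `θ`. -/
def theta : Gl 3 →* Gl 2 where
  toFun g := ⟨thetaMat g.1, thetaMat g⁻¹.1,
    by rw [← thetaMat_mul, ← Units.val_mul, mul_inv_cancel, Units.val_one, thetaMat_one],
    by rw [← thetaMat_mul, ← Units.val_mul, inv_mul_cancel, Units.val_one, thetaMat_one]⟩
  map_one' := Units.ext thetaMat_one
  map_mul' g g' := Units.ext (thetaMat_mul g g')

theorem isTheta_theta : IsTheta theta := by
  constructor
  · intro g
    have key : ∀ a b c d : ZMod 2, a * d - b * c ≠ 0 →
        ∃ a' b' c' d' : ZMod 3, IsUnit (a' * d' - b' * c') ∧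
          thetaMat !![a', b'; c', d'] = !![a, b; c, d] := by
      have : ∀ a b c d : ZMod 2, a * d - b * c ≠ 0 →
        ∃ a' b' c' d' : ZMod 3, a' * d' - b' * c' ≠ 0 ∧
          thetaMat !![a', b'; c', d'] = !![a, b; c, d] := by decide +kernel
      intro a b c d h
      obtain ⟨a', b', c', d', h1, h2⟩ := this a b c d h
      have : ∀ x : ZMod 3, x ≠ 0 → ∃ y, x * y = 1 := by decide
      obtain ⟨y, hy⟩ := this _ h1
      exact ⟨a', b', c', d', IsUnit.of_mul_eq_one y hy, h2⟩
    have h1 : (g.1).det ≠ 0 := ((Matrix.isUnit_iff_isUnit_det g.1).1 g.isUnit).ne_zero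
    rw [Matrix.det_fin_two] at h1
    obtain ⟨a', b', c', d', h2, h3⟩ := key _ _ _ _ h1
    rw [← Matrix.det_fin_two_of] at h2
    obtain ⟨w, hw⟩ := (Matrix.isUnit_iff_isUnit_det _).2 h2
    refine ⟨w, Units.ext ?_⟩
    change thetaMat w.1 = g.1
    rw [hw, h3, ← Matrix.eta_fin_two]
  · ext g
    have h := gl_three_decide (fun m => thetaMat m = 1 ↔
      ((∃ x y : ZMod 3, x ^ 2 + y ^ 2 = 1 ∧ m = !![x, -y; y, x]) ∨
        (∃ x y : ZMod 3, x ^ 2 + y ^ 2 = -1 ∧ m = !![x, y; y, -x]))) (by decide +kernel) g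
    exact Units.ext_iff.trans h

/-! The heart of the proof is that every `H` in `G36` is conjugate into one of the four subgroups
(`subConj_of_mem_G36`). The argument splits according to the images of `H` modulo 4 and modulo 9.

If the image `J` modulo 4 is proper, then up to conjugacy it contains a fixed element `w` of order
three (`cubeRootFour`), and `H4b` is the normalizer of `⟨w⟩`. If `J` is not inside `H4b`,
commutators of `w` with its conjugates give a normal Klein four-group. If `J` is not inside `H4a`,
averaging an element of determinant `-1` over `⟨w⟩` gives `1 + 2w` and `1 + 2w²`. Together these
generate the kernel of reduction modulo 2, so `J` would be everything.

If the image `J` modulo 9 is proper, note that the kernel of reduction modulo 3 is the module of 2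
by 2 matrices over the field with three elements. Its trace zero part is irreducible under
conjugation, so `J` meets it trivially (`eq_top_of_exists_mem_ker`). Hence the normal quaternion
group of order 8 modulo 3 lifts uniquely to determinant one elements of `J`. Any two such lifts are
conjugate, and `H9a` is the normalizer of one of them.

If both images are full, a Goursat argument applies. Compare on `H` the two maps to `GL₂(ℤ/2ℤ)`:
reduction modulo 2, and `θ` after reduction modulo 3. If the second kills nothing that the first
does not kill, they differ by an automorphism of `S₃`, which is inner, and `H` is conjugate into the
preimage of `H6a`. Otherwise `H` contains an element that has order three modulo 4 and is trivial
modulo 3. This forces the common quotient of the two factors to be cyclic, whence `[H, H]` is the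
whole commutator subgroup (`commutator_le_of_cubeRootFour`), a contradiction.

The four subgroups are incomparable up to conjugacy: they contain the kernels of reduction modulo 4,
4, 9 and 6, and a member of `G36` cannot contain two different ones of these kernels; `H4a` and
`H4b` are separated by hand. Maximality and representation then follow formally, by finiteness. -/

/-! ### Elements of `GL₂(ℤ/nℤ)` and reduction -/

/-- The element of `GL₂(ℤ/nℤ)` with the given entries and inverse determinant `e`. -/
def Gl.ofEntries {n : ℕ} (a b c d e : ZMod n) (h : (a * d - b * c) * e = 1) : Gl n :=
  ⟨!![a, b; c, d], !![e * d, -(e * b); -(e * c), e * a],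
    by
      ext i j
      fin_cases i <;> fin_cases j <;> simp [Matrix.mul_apply] <;>
        first | linear_combination h | ring1,
    by
      ext i j
      fin_cases i <;> fin_cases j <;> simp [Matrix.mul_apply] <;>
        first | linear_combination h | ring1⟩

@[simp]
theorem Gl.val_ofEntries {n : ℕ} (a b c d e : ZMod n) (h : (a * d - b * c) * e = 1) :
    (Gl.ofEntries a b c d e h).1 = !![a, b; c, d] := rfl

theorem Gl.forall_of_entries {n : ℕ} (P : Matrix (Fin 2) (Fin 2) (ZMod n) → Prop)
    (h : ∀ a b c d e : ZMod n, (a * d - b * c) * e = 1 → P !![a, b; c, d]) (g : Gl n) :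
    P g.1 := by
  obtain ⟨e, he⟩ := isUnit_iff_exists_inv.1 ((Matrix.isUnit_iff_isUnit_det g.1).1 g.isUnit)
  have h2 := Matrix.eta_fin_two g.1
  rw [h2, Matrix.det_fin_two_of] at he
  rw [h2]
  exact h _ _ _ _ _ he

theorem gl_four_decide (P : Matrix (Fin 2) (Fin 2) (ZMod 4) → Prop)
    (h : ∀ a b c d : ZMod 4, (a * d - b * c) ^ 2 = 1 → P !![a, b; c, d]) (g : Gl 4) : P g.1 := by
  have aux : ∀ x e : ZMod 4, x * e = 1 → x ^ 2 = 1 := by decide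
  exact Gl.forall_of_entries P (fun a b c d e he => h a b c d (aux _ e he)) g

theorem redGl_val {n d : ℕ} (h : d ∣ n) (g : Gl n) :
    (redGl h g).1 = g.1.map (ZMod.castHom h (ZMod d)) := rfl

theorem redGl_redGl {n m d : ℕ} (h : d ∣ m) (h' : m ∣ n) (h'' : d ∣ n) (g : Gl n) :
    redGl h (redGl h' g) = redGl h'' g := by
  apply Units.ext
  simp only [redGl_val, Matrix.map_map]
  congr 1
  ext x
  exact congrArg (fun f => f x) (ZMod.castHom_comp h h')

theorem det_redGl {n d : ℕ} (h : d ∣ n) (g : Gl n) :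
    ((Matrix.GeneralLinearGroup.det (redGl h g) : (ZMod d)ˣ) : ZMod d) =
      ZMod.castHom h (ZMod d) (Matrix.GeneralLinearGroup.det g : (ZMod n)ˣ) := by
  simp only [Matrix.GeneralLinearGroup.val_det_apply, redGl_val]
  rw [RingHom.map_det]; rfl

theorem zmod_thirtySix_ext : ∀ x y : ZMod 36,
    ZMod.castHom (by decide : 4 ∣ 36) (ZMod 4) x = ZMod.castHom (by decide : 4 ∣ 36) (ZMod 4) y →
    ZMod.castHom (by decide : 9 ∣ 36) (ZMod 9) x = ZMod.castHom (by decide : 9 ∣ 36) (ZMod 9) y →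
    x = y := by
  decide +kernel

theorem zmod_thirtySix_exists : ∀ (x : ZMod 4) (y : ZMod 9), ∃ z : ZMod 36,
    ZMod.castHom (by decide : 4 ∣ 36) (ZMod 4) z = x ∧
    ZMod.castHom (by decide : 9 ∣ 36) (ZMod 9) z = y := by
  decide +kernel

/-- Reduction `GL₂(ℤ/36ℤ) → GL₂(ℤ/4ℤ)`. -/
abbrev redFour : Gl 36 →* Gl 4 := redGl (by decide : 4 ∣ 36)

/-- Reduction `GL₂(ℤ/36ℤ) → GL₂(ℤ/9ℤ)`. -/
abbrev redNine : Gl 36 →* Gl 9 := redGl (by decide : 9 ∣ 36)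

/-- Reduction `GL₂(ℤ/4ℤ) → GL₂(ℤ/2ℤ)`. -/
abbrev redFourTwo : Gl 4 →* Gl 2 := redGl (by decide : 2 ∣ 4)

/-- Reduction `GL₂(ℤ/9ℤ) → GL₂(ℤ/3ℤ)`. -/
abbrev redNineThree : Gl 9 →* Gl 3 := redGl (by decide : 3 ∣ 9)

theorem gl_thirtySix_ext {g h : Gl 36} (h4 : redFour g = redFour h) (h9 : redNine g = redNine h) :
    g = h := by
  apply Units.ext
  ext i j
  exact zmod_thirtySix_ext _ _ (congrArg (fun m : Gl 4 => m.1 i j) h4)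
    (congrArg (fun m : Gl 9 => m.1 i j) h9)

theorem exists_gl_thirtySix (g : Gl 4) (h : Gl 9) : ∃ x : Gl 36, redFour x = g ∧ redNine x = h := by
  choose z hz using zmod_thirtySix_exists
  let f : Matrix (Fin 2) (Fin 2) (ZMod 4) → Matrix (Fin 2) (Fin 2) (ZMod 9) →
    Matrix (Fin 2) (Fin 2) (ZMod 36) := fun m m' => Matrix.of fun i j => z (m i j) (m' i j)
  have f4 : ∀ m m', (f m m').map (ZMod.castHom (by decide : 4 ∣ 36) (ZMod 4)) = m := by
    intro m m'
    ext i j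
    exact (hz _ _).1
  have f9 : ∀ m m', (f m m').map (ZMod.castHom (by decide : 9 ∣ 36) (ZMod 9)) = m' := by
    intro m m'
    ext i j
    exact (hz _ _).2
  have ext : ∀ m m' : Matrix (Fin 2) (Fin 2) (ZMod 36),
      m.map (ZMod.castHom (by decide : 4 ∣ 36) (ZMod 4)) =
        m'.map (ZMod.castHom (by decide : 4 ∣ 36) (ZMod 4)) →
      m.map (ZMod.castHom (by decide : 9 ∣ 36) (ZMod 9)) =
        m'.map (ZMod.castHom (by decide : 9 ∣ 36) (ZMod 9)) → m = m' := by
    intro m m' h4 h9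
    ext i j
    exact zmod_thirtySix_ext _ _ (congrFun (congrFun h4 i) j) (congrFun (congrFun h9 i) j)
  have key : ∀ (g : Gl 4) (h : Gl 9), f g.1 h.1 * f g⁻¹.1 h⁻¹.1 = 1 := by
    intro g h
    apply ext
    · rw [Matrix.map_mul, f4, f4, ← Units.val_mul, mul_inv_cancel, Units.val_one,
        Matrix.map_one _ (map_zero _) (map_one _)]
    · rw [Matrix.map_mul, f9, f9, ← Units.val_mul, mul_inv_cancel, Units.val_one,
        Matrix.map_one _ (map_zero _) (map_one _)]
  refine ⟨⟨f g.1 h.1, f g⁻¹.1 h⁻¹.1, key g h, ?_⟩, Units.ext (f4 _ _), Units.ext (f9 _ _)⟩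
  simpa only [inv_inv] using key g⁻¹ h⁻¹

theorem zmod_two_lift_four : ∀ a b c d : ZMod 2, a * d - b * c ≠ 0 → ∀ u : ZMod 4, u * u = 1 →
    ∃ a' b' c' d' : ZMod 4, (a' * d' - b' * c') = u ∧
      !![a', b'; c', d'].map (ZMod.castHom (by decide : 2 ∣ 4) (ZMod 2)) = !![a, b; c, d] := by
  decide +kernel

theorem exists_lift_four (g : Gl 2) (u : (ZMod 4)ˣ) :
    ∃ h : Gl 4, redFourTwo h = g ∧ Matrix.GeneralLinearGroup.det h = u := by
  have hu : (u : ZMod 4) * u = 1 := by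
    revert u
    decide
  have := gl_two_decide (fun m => ∃ a' b' c' d' : ZMod 4, (a' * d' - b' * c') = u ∧
      !![a', b'; c', d'].map (ZMod.castHom (by decide : 2 ∣ 4) (ZMod 2)) = m)
      (fun a b c d h => zmod_two_lift_four a b c d h u hu) g
  obtain ⟨a, b, c, d, h, h'⟩ := this
  refine ⟨Gl.ofEntries a b c d u (by rw [h, hu]), Units.ext h', Units.ext ?_⟩
  rw [Matrix.GeneralLinearGroup.val_det_apply, Gl.val_ofEntries, Matrix.det_fin_two_of, h]

theorem zmod_three_lift_nine : ∀ a b c d : ZMod 3, a * d - b * c ≠ 0 →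
    ∃ a' b' c' d' e : ZMod 9, (a' * d' - b' * c') * e = 1 ∧
      !![a', b'; c', d'].map (ZMod.castHom (by decide : 3 ∣ 9) (ZMod 3)) = !![a, b; c, d] := by
  intro a b c d h
  have h1 : ∀ x : ZMod 3, ∃ y : ZMod 9, ZMod.castHom (by decide : 3 ∣ 9) (ZMod 3) y = x := by
    decide
  have h2 : ∀ x : ZMod 9, ZMod.castHom (by decide : 3 ∣ 9) (ZMod 3) x ≠ 0 → ∃ e, x * e = 1 := by
    decide
  obtain ⟨a, rfl⟩ := h1 a
  obtain ⟨b, rfl⟩ := h1 b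
  obtain ⟨c, rfl⟩ := h1 c
  obtain ⟨d, rfl⟩ := h1 d
  simp only [← map_mul, ← map_sub] at h
  obtain ⟨e, he⟩ := h2 _ h
  refine ⟨a, b, c, d, e, he, ?_⟩
  ext i j
  fin_cases i <;> fin_cases j <;> rfl

theorem exists_lift_nine (g : Gl 3) : ∃ h : Gl 9, redNineThree h = g := by
  obtain ⟨a, b, c, d, e, h, h'⟩ := gl_three_decide (fun m => ∃ a' b' c' d' e : ZMod 9,
    (a' * d' - b' * c') * e = 1 ∧
      !![a', b'; c', d'].map (ZMod.castHom (by decide : 3 ∣ 9) (ZMod 3)) = m)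
      zmod_three_lift_nine g
  exact ⟨Gl.ofEntries a b c d e h, Units.ext h'⟩

/-! ### Group theory -/

theorem Subgroup.exists_mem_of_map_eq_top {G A : Type*} [Group G] [Group A] {p : G →* A}
    {H : Subgroup G} (hp : H.map p = ⊤) (a : A) : ∃ x ∈ H, p x = a :=
  (hp ▸ Subgroup.mem_top a : a ∈ H.map p)

/-- The elements which fix or invert `x` under conjugation. -/
def dihedralNormalizer {G : Type*} [Group G] (x : G) : Subgroup G where
  carrier := {g | g * x * g⁻¹ = x ∨ g * x * g⁻¹ = x⁻¹}
  one_mem' := by simp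
  mul_mem' := by
    intro a b ha hb
    have h : a * b * x * (a * b)⁻¹ = a * (b * x * b⁻¹) * a⁻¹ := by group
    have h' : a * x⁻¹ * a⁻¹ = (a * x * a⁻¹)⁻¹ := by group
    simp only [Set.mem_ofPred_eq] at *
    rw [h]
    rcases hb with hb | hb <;> rcases ha with ha | ha <;> simp [hb, h', ha]
  inv_mem' := by
    intro a ha
    simp only [Set.mem_ofPred_eq, inv_inv] at *
    rcases ha with ha | ha
    · left
      nth_rewrite 1 [← ha]
      group
    · right
      rw [← inv_inv (a⁻¹ * x * a), inv_inj]
      rw [eq_comm, inv_eq_iff_eq_inv] at ha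
      nth_rewrite 1 [ha]
      group

/-- If `G ⧸ K` is cyclic then `[G, G] = [K, G]`. -/
theorem commutator_le_of_cyclic_quotient {G : Type*} [Group G] (K : Subgroup G) [K.Normal] (c : G)
    (h : ∀ g : G, ∃ n : ℤ, g * c ^ n ∈ K) :
    ⁅(⊤ : Subgroup G), (⊤ : Subgroup G)⁆ ≤ ⁅K, (⊤ : Subgroup G)⁆ := by
  set L := ⁅K, (⊤ : Subgroup G)⁆ with hL
  -- Modulo `[K, G]` the image of `K` is central, and a group generated by central elements and one
  -- further element `c` is abelian.
  have hc : ∀ k ∈ K, ∀ g : G, Commute (k : G ⧸ L) (g : G ⧸ L) := by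
    intro k hk g
    rw [← commutatorElement_eq_one_iff_commute, ← QuotientGroup.mk'_apply, ← QuotientGroup.mk'_apply,
      ← map_commutatorElement, ← MonoidHom.mem_ker, QuotientGroup.ker_mk']
    exact Subgroup.commutator_mem_commutator hk (Subgroup.mem_top g)
  rw [Subgroup.commutator_le]
  intro x _ y _
  obtain ⟨m, hm⟩ := h x
  obtain ⟨n, hn⟩ := h y
  rw [← QuotientGroup.ker_mk' L, MonoidHom.mem_ker, map_commutatorElement,
    commutatorElement_eq_one_iff_commute, QuotientGroup.mk'_apply, QuotientGroup.mk'_apply]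
  have hx : x = (x * c ^ m) * (c ^ m)⁻¹ := by group
  have hy : y = (y * c ^ n) * (c ^ n)⁻¹ := by group
  have h1 : Commute (x : G ⧸ L) (y * c ^ n : G) := (hc _ hn _).symm
  have h2 : Commute (x : G ⧸ L) ((c ^ n)⁻¹ : G) := by
    rw [hx, QuotientGroup.mk_mul]
    refine Commute.mul_left (hc _ hm _) ?_
    rw [QuotientGroup.mk_inv, QuotientGroup.mk_inv, QuotientGroup.mk_zpow, QuotientGroup.mk_zpow]
    exact (((Commute.refl _).zpow_zpow m n).inv_inv)
  rw [hy, QuotientGroup.mk_mul]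
  exact h1.mul_right h2

/-- The subgroup of those `a` for which `H` has an element lying over `(a, 1)`. -/
def sliceLeft {G A B : Type*} [Group G] [Group A] [Group B] (p : G →* A) (q : G →* B)
    (H : Subgroup G) : Subgroup A :=
  (H ⊓ q.ker).map p

theorem mem_sliceLeft {G A B : Type*} [Group G] [Group A] [Group B] {p : G →* A} {q : G →* B}
    {H : Subgroup G} {a : A} : a ∈ sliceLeft p q H ↔ ∃ h ∈ H, p h = a ∧ q h = 1 := by
  simp only [sliceLeft, Subgroup.mem_map, Subgroup.mem_inf, MonoidHom.mem_ker]
  constructor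
  · rintro ⟨h, ⟨h1, h2⟩, h3⟩
    exact ⟨h, h1, h3, h2⟩
  · rintro ⟨h, h1, h3, h2⟩
    exact ⟨h, ⟨h1, h2⟩, h3⟩

section Slice

variable {G A B : Type*} [Group G] [Group A] [Group B] {p : G →* A} {q : G →* B} {H : Subgroup G}

theorem sliceLeft_normal (hp : H.map p = ⊤) : (sliceLeft p q H).Normal := by
  constructor
  intro a ha g
  obtain ⟨x, hx, rfl, hx'⟩ := mem_sliceLeft.1 ha
  obtain ⟨y, hy, rfl⟩ := Subgroup.exists_mem_of_map_eq_top hp g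
  exact mem_sliceLeft.2 ⟨y * x * y⁻¹, H.mul_mem (H.mul_mem hy hx) (H.inv_mem hy), by simp,
    by simp [hx']⟩

theorem mem_slice_of_mem_slice (h : G) (hh : h ∈ H) (hq : q h ∈ sliceLeft q p H) :
    p h ∈ sliceLeft p q H := by
  obtain ⟨x, hx, hx1, hx2⟩ := mem_sliceLeft.1 hq
  exact mem_sliceLeft.2 ⟨h * x⁻¹, H.mul_mem hh (H.inv_mem hx), by simp [hx2], by simp [hx1]⟩

/-- This is Goursat's lemma: the quotients of `A` and `B` by their slices are isomorphic through
`H`, so cyclicity passes from one to the other. -/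
theorem cyclic_slice (hp : H.map p = ⊤) (hq : H.map q = ⊤)
    (hc : ∃ c : B, ∀ b, ∃ n : ℤ, b * c ^ n ∈ sliceLeft q p H) :
    ∃ c : A, ∀ a, ∃ n : ℤ, a * c ^ n ∈ sliceLeft p q H := by
  obtain ⟨c, hc⟩ := hc
  obtain ⟨y, hy, rfl⟩ := Subgroup.exists_mem_of_map_eq_top hq c
  refine ⟨p y, fun a => ?_⟩
  obtain ⟨x, hx, rfl⟩ := Subgroup.exists_mem_of_map_eq_top hp a
  obtain ⟨n, hn⟩ := hc (q x)
  refine ⟨n, ?_⟩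
  rw [← map_zpow, ← map_mul] at hn ⊢
  exact mem_slice_of_mem_slice _ (H.mul_mem hx (H.zpow_mem hy n)) hn

/-- A commutator of the first factor lifts to `[H, H]` if the slice has cyclic quotient. -/
theorem exists_mem_commutator (hp : H.map p = ⊤)
    (hc : ∃ c : A, ∀ a, ∃ n : ℤ, a * c ^ n ∈ sliceLeft p q H) (a : A)
    (ha : a ∈ ⁅(⊤ : Subgroup A), (⊤ : Subgroup A)⁆) : ∃ x ∈ ⁅H, H⁆, p x = a ∧ q x = 1 := by
  obtain ⟨c, hc⟩ := hc
  have := sliceLeft_normal (q := q) hp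
  have h1 := commutator_le_of_cyclic_quotient (sliceLeft p q H) c hc ha
  have h2 : ⁅sliceLeft p q H, (⊤ : Subgroup A)⁆ ≤ sliceLeft p q ⁅H, H⁆ := by
    rw [Subgroup.commutator_le]
    intro k hk g _
    obtain ⟨x, hx, rfl, hx'⟩ := mem_sliceLeft.1 hk
    obtain ⟨y, hy, rfl⟩ := Subgroup.exists_mem_of_map_eq_top hp g
    exact mem_sliceLeft.2 ⟨_, Subgroup.commutator_mem_commutator hx hy,
      map_commutatorElement _ _ _, by rw [map_commutatorElement, hx', commutatorElement_one_left]⟩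
  exact mem_sliceLeft.1 (h2 h1)

end Slice

/-! ### Subgroups of `GL₂(ℤ/4ℤ)` -/

/-- An element of order three of `GL₂(ℤ/4ℤ)`; it is the square of the second generator
of `H4b`. -/
def cubeRootFour : Gl 4 := Gl.ofEntries 1 1 1 2 1 (by decide)

theorem cubeRootFour_pow_three : cubeRootFour ^ 3 = 1 := by
  apply Units.ext
  rw [Units.val_pow_eq_pow_val]
  decide +kernel

theorem cubeRootFour_inv : cubeRootFour⁻¹ = cubeRootFour ^ 2 := by
  rw [inv_eq_iff_mul_eq_one, ← pow_succ', cubeRootFour_pow_three]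

/-- The group has order 96, so subgroups of order three are Sylow and hence conjugate; moreover
`cubeRootFour` is conjugate to its inverse. -/
theorem exists_conj_cubeRootFour (t : Gl 4) (h3 : t ^ 3 = 1) (h1 : t ≠ 1) :
    ∃ g : Gl 4, g * t * g⁻¹ = cubeRootFour := by
  have key := gl_four_decide (fun m => m ^ 3 = 1 → m ≠ 1 → ∃ a b c d : ZMod 4,
    (a * d - b * c) * (a * d - b * c) = 1 ∧ !![a, b; c, d] * m = !![1, 1; 1, 2] * !![a, b; c, d])
    (by decide +kernel) t
  obtain ⟨a, b, c, d, h, h'⟩ := key (by rw [← Units.val_pow_eq_pow_val, h3, Units.val_one])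
    (fun h => h1 (Units.ext h))
  refine ⟨Gl.ofEntries a b c d _ h, ?_⟩
  rw [mul_inv_eq_iff_eq_mul]
  exact Units.ext h'

/-- The kernel of reduction modulo 2 has exponent two, so `t ^ 6 = 1`, and the fourth power isolates
the part of order three. -/
theorem pow_four_of_redGl_eq (t : Gl 4)
    (h : redFourTwo t = redFourTwo cubeRootFour) :
    (t ^ 4) ^ 3 = 1 ∧ t ^ 4 ≠ 1 := by
  have key := gl_four_decide (fun m => m.map (ZMod.castHom (by decide : 2 ∣ 4) (ZMod 2)) =
    !![1, 1; 1, 0] → (m ^ 4) ^ 3 = 1 ∧ m ^ 4 ≠ 1) (by decide +kernel) t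
  have h' : (redFourTwo cubeRootFour).1 = !![1, 1; 1, 0] := by decide
  have := key (by rw [← h', ← h]; rfl)
  constructor
  · apply Units.ext
    rw [Units.val_pow_eq_pow_val, Units.val_pow_eq_pow_val, this.1, Units.val_one]
  · intro h
    apply this.2
    rw [← Units.val_pow_eq_pow_val, h, Units.val_one]

theorem H4b_eq : H4b = dihedralNormalizer cubeRootFour := by
  apply le_antisymm
  · rw [H4b, Subgroup.closure_le]
    rintro x (rfl | rfl)
    · right
      rw [cubeRootFour_inv, mul_inv_eq_iff_eq_mul]
      apply Units.ext
      simp only [Units.val_mul, Units.val_pow_eq_pow_val]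
      decide +kernel
    · left
      rw [mul_inv_eq_iff_eq_mul]
      apply Units.ext
      simp only [Units.val_mul]
      decide +kernel
  intro g h
  have key := gl_four_decide (fun m => m * !![1, 1; 1, 2] = !![1, 1; 1, 2] * m ∨
    m * !![1, 1; 1, 2] = !![1, 1; 1, 2] ^ 2 * m →
    ∃ (i : Fin 4) (j : Fin 6), m = !![0, 1; 3, 0] ^ i.1 * !![0, 1; 1, 1] ^ j.1)
    (by decide +kernel) g
  have h' : g.1 * !![1, 1; 1, 2] = !![1, 1; 1, 2] * g.1 ∨
      g.1 * !![1, 1; 1, 2] = !![1, 1; 1, 2] ^ 2 * g.1 := by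
    have h2 : g * cubeRootFour * g⁻¹ = cubeRootFour ∨
      g * cubeRootFour * g⁻¹ = cubeRootFour⁻¹ := h
    rw [cubeRootFour_inv, mul_inv_eq_iff_eq_mul, mul_inv_eq_iff_eq_mul] at h2
    exact h2.imp Units.ext_iff.1 Units.ext_iff.1
  obtain ⟨i, j, hij⟩ := key h'
  have : g = (⟨!![0, 1; 3, 0], !![0, 3; 1, 0], by decide, by decide⟩ : Gl 4) ^ i.1 *
      (⟨!![0, 1; 1, 1], !![3, 1; 1, 0], by decide, by decide⟩ : Gl 4) ^ j.1 :=
    Units.ext (by simpa only [Units.val_mul, Units.val_pow_eq_pow_val] using hij)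
  rw [this]
  exact mul_mem (pow_mem (Subgroup.subset_closure (by simp)) _)
    (pow_mem (Subgroup.subset_closure (by simp)) _)

/-- An involution in the normal Klein four-subgroup of `GL₂(ℤ/4ℤ)`. -/
def kleinFour : Gl 4 := Gl.ofEntries 1 2 2 1 1 (by decide)

/-- The elements of order three generate a copy of `A₄`. Two of them from different Sylow subgroups
have a nontrivial commutator in its Klein four-group, whose involutions are permuted cyclically by
`cubeRootFour`. -/
theorem kleinFour_eq_of_pow_three (s : Gl 4) (h3 : s ^ 3 = 1) (h1 : s ≠ 1)
    (h : s ≠ cubeRootFour) (h' : s ≠ cubeRootFour ^ 2) :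
    ∃ k : Fin 3, cubeRootFour ^ k.1 * (cubeRootFour * s * cubeRootFour ^ 2 * s ^ 2) *
      cubeRootFour ^ (3 - k.1) = kleinFour := by
  have key := gl_four_decide (fun m => m ^ 3 = 1 → m ≠ 1 → m ≠ !![1, 1; 1, 2] →
    m ≠ !![1, 1; 1, 2] ^ 2 → ∃ k : Fin 3, !![1, 1; 1, 2] ^ k.1 *
      (!![1, 1; 1, 2] * m * !![1, 1; 1, 2] ^ 2 * m ^ 2) * !![1, 1; 1, 2] ^ (3 - k.1) =
      !![1, 2; 2, 1]) (by decide +kernel) s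
  simp only [Units.ext_iff, Units.val_mul, Units.val_pow_eq_pow_val, ne_eq, Units.val_one] at *
  exact key h3 h1 h h'

/-- Some `j` in `J` has `det ≠ ε`. Either it already has the required values, or it has determinant
`1` and `ε = -1`, and an element of determinant `-1` or its product with `j` will do. -/
theorem exists_mem_det_neg (J : Subgroup (Gl 4))
    (hdet : J.map (Matrix.GeneralLinearGroup.det : Gl 4 →* (ZMod 4)ˣ) = ⊤) (hJ : ¬ J ≤ H4a) :
    ∃ y ∈ J, epsilonGl (redFourTwo y) = 1 ∧
      Matrix.GeneralLinearGroup.det y = -1 := by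
  obtain ⟨j, hj, hj'⟩ := SetLike.not_le_iff_exists.1 hJ
  obtain ⟨d, hd, hd'⟩ := Subgroup.exists_mem_of_map_eq_top hdet (-1)
  have hj'' : ¬ (Matrix.GeneralLinearGroup.det j =
    Units.map (Int.castRingHom (ZMod 4)).toMonoidHom
      (epsilonGl (redFourTwo j))) := hj'
  have hm : Units.map (Int.castRingHom (ZMod 4)).toMonoidHom (-1) = -1 := by decide
  have hu : ∀ u : (ZMod 4)ˣ, u = 1 ∨ u = -1 := by decide
  rcases Int.units_eq_one_or (epsilonGl (redFourTwo j)) with h1 | h1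
  · rw [h1, map_one] at hj''
    exact ⟨j, hj, h1, (hu _).resolve_left hj''⟩
  · rw [h1, hm] at hj''
    rcases Int.units_eq_one_or (epsilonGl (redFourTwo d)) with h2 | h2
    · exact ⟨d, hd, h2, hd'⟩
    · refine ⟨j * d, J.mul_mem hj hd, by simp [h1, h2], ?_⟩
      rw [map_mul, hd', (hu _).resolve_right hj'', one_mul]

/-- The matrix `1 + 2 * w` for a primitive cube root of unity `w`. -/
def unipFourA : Gl 4 := Gl.ofEntries 3 2 2 1 3 (by decide)

/-- The matrix `1 + 2 * w ^ 2` for a primitive cube root of unity `w`. -/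
def unipFourB : Gl 4 := Gl.ofEntries 1 2 2 3 3 (by decide)

/-- Since `ε = 1`, the cube of `y` is `1 + 2A`, with `A` of odd trace because the determinant is
`-1`. The product of its conjugates under `w = cubeRootFour` is `1 + 2C`, where `C` commutes with
`w` modulo 2 and has odd trace. So `C` lies in the field with four elements generated by `w`, and it
is `w` or `w²`. -/
theorem norm_cubeRootFour (y : Gl 4) (h : epsilonGl (redFourTwo y) = 1)
    (hd : Matrix.GeneralLinearGroup.det y = -1) :
    y ^ 3 * (cubeRootFour * y ^ 3 * cubeRootFour ^ 2) *
      (cubeRootFour ^ 2 * y ^ 3 * cubeRootFour) = unipFourA ∨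
    y ^ 3 * (cubeRootFour * y ^ 3 * cubeRootFour ^ 2) *
      (cubeRootFour ^ 2 * y ^ 3 * cubeRootFour) = unipFourB := by
  have key := gl_four_decide (fun m =>
    (if m.map (ZMod.castHom (by decide : 2 ∣ 4) (ZMod 2)) ≠ 1 ∧
      m.map (ZMod.castHom (by decide : 2 ∣ 4) (ZMod 2)) *
      m.map (ZMod.castHom (by decide : 2 ∣ 4) (ZMod 2)) = 1 then (-1 : ℤˣ) else 1) = 1 →
    m 0 0 * m 1 1 - m 0 1 * m 1 0 = -1 →
    m ^ 3 * (!![1, 1; 1, 2] * m ^ 3 * !![1, 1; 1, 2] ^ 2) *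
      (!![1, 1; 1, 2] ^ 2 * m ^ 3 * !![1, 1; 1, 2]) = !![3, 2; 2, 1] ∨
    m ^ 3 * (!![1, 1; 1, 2] * m ^ 3 * !![1, 1; 1, 2] ^ 2) *
      (!![1, 1; 1, 2] ^ 2 * m ^ 3 * !![1, 1; 1, 2]) = !![1, 2; 2, 3]) (by decide +kernel) y
  have hd' : y.1 0 0 * y.1 1 1 - y.1 0 1 * y.1 1 0 = -1 := by
    rw [← Matrix.det_fin_two, ← Matrix.GeneralLinearGroup.val_det_apply, hd]; rfl
  simp only [Units.ext_iff, Units.val_mul, Units.val_pow_eq_pow_val]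
  exact key h hd'

theorem conj_unipFour (s : Gl 4) (h : (redFourTwo s).1 = !![0, 1; 1, 0]) :
    s * unipFourA * s⁻¹ = unipFourB ∧ s * unipFourB * s⁻¹ = unipFourA := by
  have key := gl_four_decide (fun m => m.map (ZMod.castHom (by decide : 2 ∣ 4) (ZMod 2)) =
    !![0, 1; 1, 0] → m * !![3, 2; 2, 1] = !![1, 2; 2, 3] * m ∧
      m * !![1, 2; 2, 3] = !![3, 2; 2, 1] * m) (by decide +kernel) s h
  rw [mul_inv_eq_iff_eq_mul, mul_inv_eq_iff_eq_mul]
  exact ⟨Units.ext key.1, Units.ext key.2⟩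

theorem eq_of_redGl_eq_one (g : Gl 4) (h : redFourTwo g = 1) :
    ∃ a b c d : Fin 2, g = kleinFour ^ a.1 *
      (cubeRootFour * kleinFour * cubeRootFour ^ 2) ^ b.1 * unipFourA ^ c.1 * unipFourB ^ d.1 := by
  have key := gl_four_decide (fun m => m.map (ZMod.castHom (by decide : 2 ∣ 4) (ZMod 2)) = 1 →
    ∃ a b c d : Fin 2, m = !![1, 2; 2, 1] ^ a.1 *
      (!![1, 1; 1, 2] * !![1, 2; 2, 1] * !![1, 1; 1, 2] ^ 2) ^ b.1 * !![3, 2; 2, 1] ^ c.1 *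
        !![1, 2; 2, 3] ^ d.1) (by decide +kernel) g
  simp only [Units.ext_iff, Units.val_mul, Units.val_pow_eq_pow_val] at h ⊢
  exact key h

theorem le_of_cubeRootFour_mem (J : Subgroup (Gl 4)) (h2 : J.map redFourTwo = ⊤)
    (hdet : J.map (Matrix.GeneralLinearGroup.det : Gl 4 →* (ZMod 4)ˣ) = ⊤)
    (ht : cubeRootFour ∈ J) (htop : J ≠ ⊤) : J ≤ H4a ∨ J ≤ H4b := by
  by_contra hcon
  rw [not_or] at hcon
  obtain ⟨ha, hb⟩ := hcon
  apply htop
  obtain ⟨j, hj, hjb⟩ := SetLike.not_le_iff_exists.1 hb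
  have hs : j * cubeRootFour * j⁻¹ ∈ J := J.mul_mem (J.mul_mem hj ht) (J.inv_mem hj)
  have hs3 : (j * cubeRootFour * j⁻¹) ^ 3 = 1 := by
    rw [conj_pow, cubeRootFour_pow_three]; group
  have ht1 : cubeRootFour ≠ 1 := by
    intro h
    exact absurd (Units.ext_iff.1 h) (by decide)
  have hv : kleinFour ∈ J := by
    obtain ⟨k, hk⟩ := kleinFour_eq_of_pow_three _ hs3 (fun h => ht1 (conj_eq_one_iff.1 h))
      (fun h => hjb (H4b_eq ▸ Or.inl h))
      (fun h => hjb (H4b_eq ▸ Or.inr (cubeRootFour_inv ▸ h)))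
    rw [← hk]
    exact J.mul_mem (J.mul_mem (J.pow_mem ht _) (J.mul_mem (J.mul_mem (J.mul_mem ht hs)
      (J.pow_mem ht _)) (J.pow_mem hs _))) (J.pow_mem ht _)
  obtain ⟨y, hy, hy1, hy2⟩ := exists_mem_det_neg J hdet ha
  have hw : y ^ 3 * (cubeRootFour * y ^ 3 * cubeRootFour ^ 2) *
      (cubeRootFour ^ 2 * y ^ 3 * cubeRootFour) ∈ J :=
    J.mul_mem (J.mul_mem (J.pow_mem hy _) (J.mul_mem (J.mul_mem ht (J.pow_mem hy _))
      (J.pow_mem ht _))) (J.mul_mem (J.mul_mem (J.pow_mem ht _) (J.pow_mem hy _)) ht)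
  obtain ⟨s, hs, hs'⟩ := Subgroup.exists_mem_of_map_eq_top h2
    ⟨!![0, 1; 1, 0], !![0, 1; 1, 0], by decide, by decide⟩
  have hsc := conj_unipFour s (Units.ext_iff.1 hs')
  have hAB : unipFourA ∈ J ∧ unipFourB ∈ J := by
    rcases norm_cubeRootFour y hy1 hy2 with h | h
    · rw [h] at hw
      exact ⟨hw, hsc.1 ▸ J.mul_mem (J.mul_mem hs hw) (J.inv_mem hs)⟩
    · rw [h] at hw
      exact ⟨hsc.2 ▸ J.mul_mem (J.mul_mem hs hw) (J.inv_mem hs), hw⟩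
  rw [eq_top_iff]
  intro g _
  obtain ⟨j, hj, hj'⟩ := Subgroup.exists_mem_of_map_eq_top h2 (redFourTwo g)
  have hk : g * j⁻¹ ∈ J := by
    obtain ⟨a, b, c, d, h⟩ := eq_of_redGl_eq_one (g * j⁻¹) (by
      rw [map_mul, map_inv, hj', mul_inv_cancel])
    rw [h]
    exact J.mul_mem (J.mul_mem (J.mul_mem (J.pow_mem hv _) (J.pow_mem (J.mul_mem
      (J.mul_mem ht hv) (J.pow_mem ht _)) _)) (J.pow_mem hAB.1 _)) (J.pow_mem hAB.2 _)
  simpa using J.mul_mem hk hj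

instance H4a_normal : H4a.Normal := by
  constructor
  intro n (hn : Matrix.GeneralLinearGroup.det n = _) g
  change Matrix.GeneralLinearGroup.det (g * n * g⁻¹) = _
  rw [map_mul, map_mul, map_mul, map_mul, hn, map_inv, map_inv, mul_right_comm, mul_inv_cancel,
    mul_right_comm, mul_inv_cancel]

/-- A proper subgroup of `GL₂(ℤ/4ℤ)` with full determinant and full reduction modulo `2` lies in
`H4a` or in a conjugate of `H4b`. -/
theorem le_H4a_or_conj_le_H4b (J : Subgroup (Gl 4))
    (h2 : J.map redFourTwo = ⊤)
    (hdet : J.map (Matrix.GeneralLinearGroup.det : Gl 4 →* (ZMod 4)ˣ) = ⊤) (htop : J ≠ ⊤) :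
    J ≤ H4a ∨ ∃ g : Gl 4, ∀ j ∈ J, g * j * g⁻¹ ∈ H4b := by
  -- After conjugation `J` contains `cubeRootFour`; since `H4a` is normal, the conjugation can be
  -- undone in the first alternative.
  obtain ⟨t, ht, ht'⟩ := Subgroup.exists_mem_of_map_eq_top h2
    (redFourTwo cubeRootFour)
  obtain ⟨g, hg⟩ := exists_conj_cubeRootFour _ (pow_four_of_redGl_eq t ht').1
    (pow_four_of_redGl_eq t ht').2
  have hmap : ∀ {M : Type} [Group M] (f : Gl 4 →* M), J.map f = ⊤ →
      (J.map (MulAut.conj g).toMonoidHom).map f = ⊤ := by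
    intro M _ f hf
    rw [eq_top_iff]
    intro x _
    obtain ⟨j, hj, hj'⟩ := Subgroup.exists_mem_of_map_eq_top hf ((f g)⁻¹ * x * f g)
    exact ⟨_, ⟨j, hj, rfl⟩, by simp [hj', mul_assoc]⟩
  have := le_of_cubeRootFour_mem (J.map (MulAut.conj g).toMonoidHom) (hmap _ h2) (hmap _ hdet)
    ⟨t ^ 4, J.pow_mem ht 4, hg⟩ (fun h => htop (by
      rw [eq_top_iff]
      intro x _
      obtain ⟨j, hj, hj'⟩ := Subgroup.exists_mem_of_map_eq_top h
        (g * x * g⁻¹)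
      have : j = x := by simpa using hj'
      exact this ▸ hj))
  rcases this with h | h
  · left
    intro j hj
    have := H4a_normal.conj_mem _ (h ⟨j, hj, rfl⟩) g⁻¹
    simpa [mul_assoc] using this
  · exact Or.inr ⟨g, fun j hj => h ⟨j, hj, rfl⟩⟩

/-! ### The kernel of `GL₂(ℤ/9ℤ) → GL₂(ℤ/3ℤ)` -/

theorem gl_nine_ker_decide (P : Matrix (Fin 2) (Fin 2) (ZMod 9) → Prop)
    (h : ∀ a b c d : Fin 3, P !![1 + 3 * (a.1 : ZMod 9), 3 * (b.1 : ZMod 9);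
      3 * (c.1 : ZMod 9), 1 + 3 * (d.1 : ZMod 9)]) (g : Gl 9) (hg : redNineThree g = 1) :
    P g.1 := by
  have h0 : ∀ x : ZMod 9, ZMod.castHom (by decide : 3 ∣ 9) (ZMod 3) x = 0 →
      ∃ y : Fin 3, x = 3 * (y.1 : ZMod 9) := by decide
  have h1 : ∀ x : ZMod 9, ZMod.castHom (by decide : 3 ∣ 9) (ZMod 3) x = 1 →
      ∃ y : Fin 3, x = 1 + 3 * (y.1 : ZMod 9) := by decide
  have he : ∀ i j, ZMod.castHom (by decide : 3 ∣ 9) (ZMod 3) (g.1 i j) = (1 : Matrix _ _ _) i j :=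
    fun i j => congrArg (fun m : Gl 3 => m.1 i j) hg
  obtain ⟨a, ha⟩ := h1 _ (he 0 0)
  obtain ⟨b, hb⟩ := h0 _ (he 0 1)
  obtain ⟨c, hc⟩ := h0 _ (he 1 0)
  obtain ⟨d, hd⟩ := h1 _ (he 1 1)
  rw [Matrix.eta_fin_two g.1, ha, hb, hc, hd]
  exact h a b c d

theorem commute_of_redNineThree_eq_one {p q : Gl 9} (hp : redNineThree p = 1)
    (hq : redNineThree q = 1) : Commute p q := by
  have key : ∀ g : Gl 9, redNineThree g = 1 →
      ∃ A : Matrix (Fin 2) (Fin 2) (ZMod 9), g.1 = 1 + (3 : ZMod 9) • A := by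
    refine fun g hg => gl_nine_ker_decide (fun m => ∃ A, m = 1 + (3 : ZMod 9) • A) ?_ g hg
    intro a b c d
    refine ⟨!![(a.1 : ZMod 9), (b.1 : ZMod 9); (c.1 : ZMod 9), (d.1 : ZMod 9)], ?_⟩
    ext i j
    fin_cases i <;> fin_cases j <;> simp
  obtain ⟨A, hA⟩ := key p hp
  obtain ⟨B, hB⟩ := key q hq
  apply Units.ext
  have h9 : (3 * 3 : ZMod 9) = 0 := by decide
  simp only [Units.val_mul, hA, hB, mul_add, add_mul, one_mul, mul_one, smul_mul_smul_comm, h9,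
    zero_smul]
  abel

theorem pow_three_of_redNineThree_eq_one {p : Gl 9} (hp : redNineThree p = 1) : p ^ 3 = 1 := by
  apply Units.ext
  rw [Units.val_pow_eq_pow_val]
  exact gl_nine_ker_decide (fun m => m ^ 3 = 1) (by decide +kernel) p hp

/-- The kernel is abelian, so conjugation on it factors through `GL₂(ℤ/3ℤ)`. -/
theorem conj_eq_of_redNineThree_eq {g g' p : Gl 9} (h : redNineThree g = redNineThree g')
    (hp : redNineThree p = 1) : g * p * g⁻¹ = g' * p * g'⁻¹ := by
  have h1 : redNineThree (g'⁻¹ * g) = 1 := by rw [map_mul, map_inv, h, inv_mul_cancel]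
  have h2 := (commute_of_redNineThree_eq_one h1 hp).eq
  calc g * p * g⁻¹ = g' * (g'⁻¹ * g * p) * g⁻¹ := by group
    _ = g' * p * g'⁻¹ := by rw [h2]; group

/-- In determinant one `g ^ 4` is trivial or a transvection, up to conjugacy. A transvection is
inverted by conjugation with a matrix of determinant `-1`, though not inside `SL₂`. -/
theorem gl_three_exists_conj_inv (g : Gl 3)
    (h : g.1 0 0 * g.1 1 1 - g.1 0 1 * g.1 1 0 = 1) : ∃ x : Gl 3, x * g ^ 4 * x⁻¹ = (g ^ 4)⁻¹ := by
  have key := gl_three_decide (fun m => m 0 0 * m 1 1 - m 0 1 * m 1 0 = 1 →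
    ∃ a b c d : ZMod 3, (a * d - b * c) * (a * d - b * c) = 1 ∧
      m ^ 4 * (!![a, b; c, d] * m ^ 4) = !![a, b; c, d]) (by decide +kernel) g h
  obtain ⟨a, b, c, d, h, h'⟩ := key
  refine ⟨Gl.ofEntries a b c d _ h, ?_⟩
  rw [mul_inv_eq_iff_eq_mul, eq_inv_mul_iff_mul_eq]
  apply Units.ext
  simp only [Units.val_mul, Units.val_pow_eq_pow_val]
  exact h'

theorem det_entries_eq_one {n : ℕ} {g : Gl n} (h : Matrix.GeneralLinearGroup.det g = 1) :
    g.1 0 0 * g.1 1 1 - g.1 0 1 * g.1 1 0 = 1 := by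
  rw [← Matrix.det_fin_two, ← Matrix.GeneralLinearGroup.val_det_apply, h, Units.val_one]

/-- A subgroup of `GL₂(ℤ/9ℤ)` with full determinant and full reduction modulo `3` has an element
of determinant `7` in the kernel of reduction. -/
theorem exists_mem_ker_det_seven (J : Subgroup (Gl 9)) (h3 : J.map redNineThree = ⊤)
    (hdet : J.map (Matrix.GeneralLinearGroup.det : Gl 9 →* (ZMod 9)ˣ) = ⊤) :
    ∃ T ∈ J, redNineThree T = 1 ∧
      ((Matrix.GeneralLinearGroup.det T : (ZMod 9)ˣ) : ZMod 9) = 7 := by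
  obtain ⟨d, hd, hd'⟩ := Subgroup.exists_mem_of_map_eq_top hdet ⟨4, 7, by decide, by decide⟩
  obtain ⟨x, hx⟩ := gl_three_exists_conj_inv (redNineThree d) (by
    apply det_entries_eq_one
    apply Units.ext
    rw [det_redGl, hd']
    decide)
  obtain ⟨y, hy, rfl⟩ := Subgroup.exists_mem_of_map_eq_top h3 x
  -- Modulo 3 the first factor is the inverse of the second, while the determinant is `4 ^ 8 = 7`
  -- modulo 9.
  refine ⟨y * d ^ 4 * y⁻¹ * d ^ 4, J.mul_mem (J.mul_mem (J.mul_mem hy (J.pow_mem hd _))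
    (J.inv_mem hy)) (J.pow_mem hd _), ?_, ?_⟩
  · rw [map_mul, map_mul, map_mul, map_inv, map_pow, hx, inv_mul_cancel]
  · rw [map_mul, map_mul, map_mul, map_inv, map_pow, mul_right_comm _ _ (_)⁻¹, mul_inv_cancel,
      one_mul, hd']
    decide

/-- An upper unitriangular matrix. -/
def unipNine : Gl 9 := Gl.ofEntries 1 1 0 1 1 (by decide)

/-- A lower unitriangular matrix. -/
def unipNineLower : Gl 9 := Gl.ofEntries 1 0 1 1 1 (by decide)

/-- The permutation matrix of the transposition. -/
def swapNine : Gl 9 := Gl.ofEntries 0 1 1 0 (-1) (by decide)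

/-- A transvection in the kernel of reduction modulo `3`. -/
def kerUpper : Gl 9 := Gl.ofEntries 1 3 0 1 1 (by decide)

/-- Writing `N = 1 + 3A`, the map `f` sends `A` to `uAu⁻¹ - A` with `u` unipotent, as squaring is
inversion here. On trace zero matrices this is a single nilpotent Jordan block of size three, with
kernel spanned by the direction of `kerUpper`, so the last nontrivial iterate generates
`⟨kerUpper⟩`. -/
theorem kerUpper_mem (L : Subgroup (Gl 9)) [hL : L.Normal] (N : Gl 9) (hN : N ∈ L)
    (h3 : redNineThree N = 1) (hdet : Matrix.GeneralLinearGroup.det N = 1) (h1 : N ≠ 1) :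
    kerUpper ∈ L := by
  let f : Gl 9 → Gl 9 := fun x => unipNine * x * unipNine⁻¹ * x ^ 2
  have hf : ∀ x ∈ L, f x ∈ L := fun x hx => L.mul_mem (hL.conj_mem x hx _) (L.pow_mem hx 2)
  have key : ∃ k : Fin 3, N ^ k.1 = kerUpper ∨ f N ^ k.1 = kerUpper ∨
      f (f N) ^ k.1 = kerUpper := by
    have := gl_nine_ker_decide (fun m => m 0 0 * m 1 1 - m 0 1 * m 1 0 = 1 → m ≠ 1 →
      ∃ k : Fin 3, m ^ k.1 = !![1, 3; 0, 1] ∨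
        (!![1, 1; 0, 1] * m * !![1, -1; 0, 1] * m ^ 2) ^ k.1 = !![1, 3; 0, 1] ∨
        (!![1, 1; 0, 1] * (!![1, 1; 0, 1] * m * !![1, -1; 0, 1] * m ^ 2) * !![1, -1; 0, 1] *
          (!![1, 1; 0, 1] * m * !![1, -1; 0, 1] * m ^ 2) ^ 2) ^ k.1 = !![1, 3; 0, 1])
      (by decide +kernel) N h3 (det_entries_eq_one hdet) (fun h => h1 (Units.ext h))
    have hu : unipNine⁻¹.1 = !![1, -1; 0, 1] := by decide
    simp only [f, Units.ext_iff, Units.val_mul, Units.val_pow_eq_pow_val, hu]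
    exact this
  obtain ⟨k, h | h | h⟩ := key <;> rw [← h]
  · exact L.pow_mem hN _
  · exact L.pow_mem (hf _ hN) _
  · exact L.pow_mem (hf _ (hf _ hN)) _

/-- The conjugates of the upper nilpotent direction under the swap and a lower transvection complete
it to a basis of the trace zero matrices. -/
theorem mem_of_kerUpper_mem (L : Subgroup (Gl 9)) [hL : L.Normal] (h : kerUpper ∈ L) (N : Gl 9)
    (h3 : redNineThree N = 1) (hdet : Matrix.GeneralLinearGroup.det N = 1) : N ∈ L := by
  have key : ∃ a b c : Fin 3, N = kerUpper ^ a.1 * (swapNine * kerUpper * swapNine⁻¹) ^ b.1 *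
      (unipNineLower * kerUpper * unipNineLower⁻¹) ^ c.1 := by
    have := gl_nine_ker_decide (fun m => m 0 0 * m 1 1 - m 0 1 * m 1 0 = 1 →
      ∃ a b c : Fin 3, m = !![1, 3; 0, 1] ^ a.1 *
        (!![0, 1; 1, 0] * !![1, 3; 0, 1] * !![0, 1; 1, 0]) ^ b.1 *
        (!![1, 0; 1, 1] * !![1, 3; 0, 1] * !![1, 0; -1, 1]) ^ c.1)
      (by decide +kernel) N h3 (det_entries_eq_one hdet)
    have hu : unipNineLower⁻¹.1 = !![1, 0; -1, 1] := by decide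
    have hs : swapNine⁻¹.1 = !![0, 1; 1, 0] := by decide
    simp only [Units.ext_iff, Units.val_mul, Units.val_pow_eq_pow_val, hu, hs]
    exact this
  obtain ⟨a, b, c, rfl⟩ := key
  exact L.mul_mem (L.mul_mem (L.pow_mem h _) (L.pow_mem (hL.conj_mem _ h _) _))
    (L.pow_mem (hL.conj_mem _ h _) _)

theorem inf_ker_normal (J : Subgroup (Gl 9)) (h3 : J.map redNineThree = ⊤) :
    (J ⊓ redNineThree.ker).Normal := by
  constructor
  rintro n ⟨hn, hn'⟩ g
  obtain ⟨j, hj, hj'⟩ := Subgroup.exists_mem_of_map_eq_top h3 (redNineThree g)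
  refine ⟨?_, redNineThree.normal_ker.conj_mem _ hn' _⟩
  rw [SetLike.mem_coe, conj_eq_of_redNineThree_eq hj'.symm hn']
  exact J.mul_mem (J.mul_mem hj hn) (J.inv_mem hj)

/-- By irreducibility `J` contains all kernel elements of determinant one; powers of an element of
determinant `7` account for the remaining kernel determinants `1, 4, 7`. -/
theorem eq_top_of_exists_mem_ker (J : Subgroup (Gl 9)) (h3 : J.map redNineThree = ⊤)
    (hdet : J.map (Matrix.GeneralLinearGroup.det : Gl 9 →* (ZMod 9)ˣ) = ⊤) (N : Gl 9) (hN : N ∈ J)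
    (hN3 : redNineThree N = 1) (hNdet : Matrix.GeneralLinearGroup.det N = 1) (h1 : N ≠ 1) :
    J = ⊤ := by
  have := inf_ker_normal J h3
  have hU := kerUpper_mem (J ⊓ redNineThree.ker) N ⟨hN, hN3⟩ hN3 hNdet h1
  obtain ⟨T, hT, hT3, hT7⟩ := exists_mem_ker_det_seven J h3 hdet
  rw [eq_top_iff]
  intro g _
  obtain ⟨j, hj, hj'⟩ := Subgroup.exists_mem_of_map_eq_top h3 (redNineThree g)
  have hk : redNineThree (g * j⁻¹) = 1 := by rw [map_mul, map_inv, hj', mul_inv_cancel]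
  obtain ⟨k, hk'⟩ : ∃ k : Fin 3, Matrix.GeneralLinearGroup.det (g * j⁻¹ * T ^ k.1) = 1 := by
    have h1 : ∀ x : ZMod 9, ZMod.castHom (by decide : 3 ∣ 9) (ZMod 3) x = 1 →
      ∃ k : Fin 3, x * 7 ^ k.1 = 1 := by decide
    obtain ⟨k, hk'⟩ := h1 (Matrix.GeneralLinearGroup.det (g * j⁻¹) : (ZMod 9)ˣ) (by
      rw [← det_redGl, hk, map_one, Units.val_one])
    exact ⟨k, Units.ext (by
      rw [map_mul, map_pow, Units.val_mul, Units.val_pow_eq_pow_val, hT7, hk', Units.val_one])⟩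
  have := (mem_of_kerUpper_mem _ hU (g * j⁻¹ * T ^ k.1) (by
    rw [map_mul, map_pow, hk, hT3, one_pow, one_mul]) hk').1
  simpa using J.mul_mem (J.mul_mem this (J.inv_mem (J.pow_mem hT k.1))) hj

/-! ### The quaternion subgroup of `GL₂(ℤ/9ℤ)` -/

/-- A lift of `i` to `SL₂(ℤ/9ℤ)`. -/
def quatI : Gl 9 := Gl.ofEntries 0 4 2 0 1 (by decide)

/-- A lift of `j` to `SL₂(ℤ/9ℤ)`. -/
def quatJ : Gl 9 := Gl.ofEntries 2 1 4 7 1 (by decide)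

/-- The matrices of the quaternion group generated by `quatI` and `quatJ`. -/
def quatList : List (Matrix (Fin 2) (Fin 2) (ZMod 9)) :=
  [1, -1, !![0, 4; 2, 0], !![0, 5; 7, 0], !![2, 1; 4, 7], !![7, 8; 5, 2],
    !![7, 1; 4, 2], !![2, 8; 5, 7]]

theorem List.forall_mem_of_all {α : Type*} (P : α → Prop) [DecidablePred P] (l : List α)
    (h : (l.all fun a => decide (P a)) = true) : ∀ a ∈ l, P a := by
  simpa using h

theorem quatList_mul : ∀ m ∈ quatList, ∀ m' ∈ quatList, m * m' ∈ quatList := by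
  have := List.forall_mem_of_all (fun m => (quatList.all fun m' => decide (m * m' ∈ quatList)) = true)
    quatList (by decide +kernel)
  exact fun m hm => List.forall_mem_of_all _ quatList (this m hm)

theorem quatList_inv : ∀ m ∈ quatList, m ^ 3 ∈ quatList ∧ m ^ 4 = 1 :=
  List.forall_mem_of_all _ _ (by decide +kernel)

/-- The quaternion group generated by `quatI` and `quatJ`. -/
def quatNine : Subgroup (Gl 9) where
  carrier := {g | g.1 ∈ quatList}
  one_mem' := by
    change (1 : Matrix (Fin 2) (Fin 2) (ZMod 9)) ∈ quatList
    decide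
  mul_mem' {a b} ha hb := quatList_mul _ ha _ hb
  inv_mem' {a} ha := by
    have h := quatList_inv _ ha
    have h4 : a ^ 4 = 1 := Units.ext (by rw [Units.val_pow_eq_pow_val, h.2, Units.val_one])
    have h3 : a⁻¹ = a ^ 3 := by rw [inv_eq_iff_mul_eq_one, ← pow_succ', h4]
    change a⁻¹.1 ∈ quatList
    rw [h3, Units.val_pow_eq_pow_val]
    exact h.1

theorem mem_quatNine {g : Gl 9} : g ∈ quatNine ↔ g.1 ∈ quatList := Iff.rfl

theorem quatI_mem : quatI ∈ quatNine := by
  rw [mem_quatNine]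
  decide

theorem quatJ_mem : quatJ ∈ quatNine := by
  rw [mem_quatNine]
  decide

theorem pow_four_of_mem_quatNine {q : Gl 9} (hq : q ∈ quatNine) : q ^ 4 = 1 :=
  Units.ext (by rw [Units.val_pow_eq_pow_val, (quatList_inv _ hq).2, Units.val_one])

/-- The quotient `q * q'⁻¹` has order dividing both 4 and 3. -/
theorem eq_of_mem_quatNine {q q' : Gl 9} (hq : q ∈ quatNine) (hq' : q' ∈ quatNine)
    (h : redNineThree q = redNineThree q') : q = q' := by
  have h4 := pow_four_of_mem_quatNine (quatNine.mul_mem hq (quatNine.inv_mem hq'))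
  have h3 := pow_three_of_redNineThree_eq_one (p := q * q'⁻¹) (by
    rw [map_mul, map_inv, h, mul_inv_cancel])
  rw [pow_succ, h3, one_mul] at h4
  exact mul_inv_eq_one.1 h4

theorem mem_closure_of_mem_quatNine {q : Gl 9} (hq : q ∈ quatNine) :
    q ∈ Subgroup.closure {quatI, quatJ} := by
  have h : ∀ m ∈ quatList, ∃ a b : Fin 4, m = !![0, 4; 2, 0] ^ a.1 * !![2, 1; 4, 7] ^ b.1 :=
    List.forall_mem_of_all _ _ (by decide +kernel)
  obtain ⟨a, b, h⟩ := h _ hq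
  have : q = quatI ^ a.1 * quatJ ^ b.1 := by
    apply Units.ext
    rw [Units.val_mul, Units.val_pow_eq_pow_val, Units.val_pow_eq_pow_val]
    exact h
  rw [this]
  exact mul_mem (pow_mem (Subgroup.subset_closure (by simp)) _)
    (pow_mem (Subgroup.subset_closure (by simp)) _)

theorem conj_mem_quatNine {g : Gl 9} (hi : g * quatI * g⁻¹ ∈ quatNine)
    (hj : g * quatJ * g⁻¹ ∈ quatNine) {q : Gl 9} (hq : q ∈ quatNine) :
    g * q * g⁻¹ ∈ quatNine := by
  have hle : Subgroup.closure {quatI, quatJ} ≤ quatNine.comap (MulAut.conj g).toMonoidHom := by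
    rw [Subgroup.closure_le]
    rintro x (rfl | rfl)
    · exact hi
    · exact hj
  exact hle (mem_closure_of_mem_quatNine hq)

/-- The normalizer of the quaternion group. -/
def quatNormalizer : Subgroup (Gl 9) where
  carrier := {g | (g * quatI * g⁻¹ ∈ quatNine ∧ g * quatJ * g⁻¹ ∈ quatNine) ∧
    g⁻¹ * quatI * g⁻¹⁻¹ ∈ quatNine ∧ g⁻¹ * quatJ * g⁻¹⁻¹ ∈ quatNine}
  one_mem' := by simp [quatI_mem, quatJ_mem]
  mul_mem' := by
    rintro a b ⟨⟨h1, h2⟩, h3, h4⟩ ⟨⟨h5, h6⟩, h7, h8⟩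
    have h : ∀ x : Gl 9, a * b * x * (a * b)⁻¹ = a * (b * x * b⁻¹) * a⁻¹ := fun x => by group
    have h' : ∀ x : Gl 9, (a * b)⁻¹ * x * (a * b)⁻¹⁻¹ = b⁻¹ * (a⁻¹ * x * a⁻¹⁻¹) * b⁻¹⁻¹ :=
      fun x => by group
    rw [Set.mem_ofPred_eq, h, h, h', h']
    exact ⟨⟨conj_mem_quatNine h1 h2 h5, conj_mem_quatNine h1 h2 h6⟩,
      conj_mem_quatNine h7 h8 h3, conj_mem_quatNine h7 h8 h4⟩
  inv_mem' := by
    rintro a ⟨h1, h2⟩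
    exact ⟨h2, by simpa using h1⟩

theorem H9a_le : H9a ≤ quatNormalizer := by
  have key : ∀ (g : Gl 9) (h : g.1 * quatI.1 * g⁻¹.1 ∈ quatList ∧ g.1 * quatJ.1 * g⁻¹.1 ∈ quatList ∧
      g⁻¹.1 * quatI.1 * g.1 ∈ quatList ∧ g⁻¹.1 * quatJ.1 * g.1 ∈ quatList),
      g ∈ quatNormalizer := fun g h => ⟨⟨h.1, h.2.1⟩, by
        rw [inv_inv]
        exact ⟨h.2.2.1, h.2.2.2⟩⟩
  rw [H9a, Subgroup.closure_le]
  rintro x (rfl | rfl | rfl | rfl) <;> refine key _ ?_ <;> decide +kernel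

theorem exists_mem_H9a (g : Gl 3) : ∃ h ∈ H9a, redNineThree h = g := by
  -- The Bruhat decomposition over the field with three elements: the Borel subgroup and the big
  -- cell. Each factor is the reduction of a generator of `H9a`.
  have key := gl_three_decide (fun m => ∃ (a b : Fin 2) (c d : Fin 3),
    m = !![-1, 0; 0, 1] ^ a.1 * !![2, 0; 0, 2] ^ b.1 * !![1, 1; 0, 1] ^ c.1 ∨
    m = !![-1, 0; 0, 1] ^ a.1 * !![2, 0; 0, 2] ^ b.1 * !![1, 1; 0, 1] ^ c.1 *
      !![0, 1; 2, 0] * !![1, 1; 0, 1] ^ d.1)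
    (by decide +kernel) g
  let A : Gl 9 := ⟨!![0, 4; 2, 0], !![0, 5; 7, 0], by decide, by decide⟩
  let B : Gl 9 := ⟨!![4, 1; -3, 4], !![4, -1; 3, 4], by decide, by decide⟩
  let C : Gl 9 := ⟨!![2, 0; 0, 2], !![5, 0; 0, 5], by decide, by decide⟩
  let D : Gl 9 := ⟨!![-1, 0; 0, 1], !![-1, 0; 0, 1], by decide, by decide⟩
  have hA : A ∈ H9a := Subgroup.subset_closure (by simp [A])
  have hB : B ∈ H9a := Subgroup.subset_closure (by simp [B])
  have hC : C ∈ H9a := Subgroup.subset_closure (by simp [C])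
  have hD : D ∈ H9a := Subgroup.subset_closure (by simp [D])
  have rA : (redNineThree A).1 = !![0, 1; 2, 0] := by decide
  have rB : (redNineThree B).1 = !![1, 1; 0, 1] := by decide
  have rC : (redNineThree C).1 = !![2, 0; 0, 2] := by decide
  have rD : (redNineThree D).1 = !![-1, 0; 0, 1] := by decide
  obtain ⟨a, b, c, d, h | h⟩ := key
  · refine ⟨D ^ a.1 * C ^ b.1 * B ^ c.1, mul_mem (mul_mem (pow_mem hD _) (pow_mem hC _))
      (pow_mem hB _), Units.ext ?_⟩
    rw [map_mul, map_mul, map_pow, map_pow, map_pow, Units.val_mul, Units.val_mul,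
      Units.val_pow_eq_pow_val, Units.val_pow_eq_pow_val, Units.val_pow_eq_pow_val, rB, rC, rD, h]
  · refine ⟨D ^ a.1 * C ^ b.1 * B ^ c.1 * A * B ^ d.1, mul_mem (mul_mem (mul_mem
      (mul_mem (pow_mem hD _) (pow_mem hC _)) (pow_mem hB _)) hA) (pow_mem hB _), Units.ext ?_⟩
    rw [map_mul, map_mul, map_mul, map_mul, map_pow, map_pow, map_pow, map_pow, Units.val_mul,
      Units.val_mul, Units.val_mul, Units.val_mul, Units.val_pow_eq_pow_val,
      Units.val_pow_eq_pow_val, Units.val_pow_eq_pow_val, Units.val_pow_eq_pow_val,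
      rA, rB, rC, rD, h]

/-- An element of the normalizer can be corrected by `H9a` to be trivial modulo 3. It then acts
trivially on the quaternion group, so it is scalar, hence a power of `2`. -/
theorem H9a_eq : H9a = quatNormalizer := by
  refine le_antisymm H9a_le fun g hg => ?_
  obtain ⟨h, hh, hgh⟩ := exists_mem_H9a (redNineThree g)
  have hn := quatNormalizer.mul_mem hg (quatNormalizer.inv_mem (H9a_le hh))
  have hk : redNineThree (g * h⁻¹) = 1 := by rw [map_mul, map_inv, hgh, mul_inv_cancel]
  set n := g * h⁻¹ with hndef
  have hi : n * quatI * n⁻¹ = quatI := eq_of_mem_quatNine hn.1.1 quatI_mem (by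
    rw [map_mul, map_mul, map_inv, hk]; group)
  have hj : n * quatJ * n⁻¹ = quatJ := eq_of_mem_quatNine hn.1.2 quatJ_mem (by
    rw [map_mul, map_mul, map_inv, hk]; group)
  rw [mul_inv_eq_iff_eq_mul] at hi hj
  obtain ⟨k, hk'⟩ := gl_nine_ker_decide (fun m => m * !![0, 4; 2, 0] = !![0, 4; 2, 0] * m →
    m * !![2, 1; 4, 7] = !![2, 1; 4, 7] * m → ∃ k : Fin 6, m = !![2, 0; 0, 2] ^ k.1)
    (by decide +kernel) n hk (Units.ext_iff.1 hi) (Units.ext_iff.1 hj)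
  have hmem : n ∈ H9a := by
    have : n = (⟨!![2, 0; 0, 2], !![5, 0; 0, 5], by decide, by decide⟩ : Gl 9) ^ k.1 :=
      Units.ext (by rw [Units.val_pow_eq_pow_val, hk'])
    rw [this]
    exact pow_mem (Subgroup.subset_closure (by simp)) _
  have := H9a.mul_mem hmem hh
  simpa [hndef] using this

/-- A pair of anticommuting square roots of `-1` lifting `quatI` and `quatJ` modulo `3` is
conjugate to `(quatI, quatJ)`. -/
theorem exists_conj_quat (x y : Gl 9) (hx : redNineThree x = redNineThree quatI)
    (hy : redNineThree y = redNineThree quatJ) (hx2 : x.1 * x.1 = -1) (hy2 : y.1 * y.1 = -1)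
    (hyx : y.1 * x.1 = -(x.1 * y.1)) :
    ∃ g : Gl 9, g * x * g⁻¹ = quatI ∧ g * y * g⁻¹ = quatJ := by
  set I := quatI.1 with hI
  set J := quatJ.1 with hJ
  have hII : I * I = -1 := by decide +kernel
  have hJJ : J * J = -1 := by decide +kernel
  have hJI : J * I = -(I * J) := by decide +kernel
  -- This is the averaging intertwiner, the sum of `q * ρ(q)⁻¹` over the quaternion group modulo
  -- sign, where `ρ` sends `I` to `x` and `J` to `y`.
  set G := 1 - I * x.1 - J * y.1 - I * J * (x.1 * y.1) with hG
  have h1 : G * x.1 = I * G := by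
    have e1 : x.1 * y.1 * x.1 = y.1 := by
      rw [mul_assoc, hyx, mul_neg, ← mul_assoc, hx2]; simp
    calc G * x.1 = x.1 - I * (x.1 * x.1) - J * (y.1 * x.1) - I * J * (x.1 * y.1 * x.1) := by
          rw [hG]; noncomm_ring
      _ = I - I * I * x.1 - I * J * y.1 - I * I * J * (x.1 * y.1) := by
          rw [e1, hx2, hyx, hII]; noncomm_ring
      _ = I * G := by rw [hG]; noncomm_ring
  have h2 : G * y.1 = J * G := by
    have e1 : J * I * J = I := by
      rw [hJI, neg_mul, mul_assoc, hJJ]; simp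
    calc G * y.1 = y.1 - I * (x.1 * y.1) - J * (y.1 * y.1) - I * J * x.1 * (y.1 * y.1) := by
          rw [hG]; noncomm_ring
      _ = J - J * I * x.1 - J * J * y.1 - J * I * J * (x.1 * y.1) := by
          rw [e1, hy2, hJJ, hJI]; noncomm_ring
      _ = J * G := by rw [hG]; noncomm_ring
  have hu : IsUnit G.det := by
    -- Modulo 3 each of the four summands is the identity, so `G` reduces to `4 = 1` and is
    -- invertible.
    have hr : G.map (ZMod.castHom (by decide : 3 ∣ 9) (ZMod 3)) = 1 := by
      have hx' : x.1.map (ZMod.castHom (by decide : 3 ∣ 9) (ZMod 3)) = !![0, 1; 2, 0] := by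
        rw [← redGl_val, hx]; decide
      have hy' : y.1.map (ZMod.castHom (by decide : 3 ∣ 9) (ZMod 3)) = !![2, 1; 1, 1] := by
        rw [← redGl_val, hy]; decide
      have hI' : I.map (ZMod.castHom (by decide : 3 ∣ 9) (ZMod 3)) = !![0, 1; 2, 0] := by decide
      have hJ' : J.map (ZMod.castHom (by decide : 3 ∣ 9) (ZMod 3)) = !![2, 1; 1, 1] := by decide
      rw [← RingHom.mapMatrix_apply] at *
      rw [hG, map_sub, map_sub, map_sub, map_mul, map_mul, map_mul, map_mul, map_mul, map_one]
      simp only [RingHom.mapMatrix_apply] at *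
      rw [hx', hy', hI', hJ']
      decide +kernel
    have hd : ZMod.castHom (by decide : 3 ∣ 9) (ZMod 3) G.det = 1 := by
      rw [RingHom.map_det, RingHom.mapMatrix_apply, hr, Matrix.det_one]
    have : ∀ z : ZMod 9, ZMod.castHom (by decide : 3 ∣ 9) (ZMod 3) z = 1 → ∃ w, z * w = 1 := by
      decide
    exact isUnit_iff_exists_inv.2 (this _ hd)
  obtain ⟨g, hg⟩ := (Matrix.isUnit_iff_isUnit_det G).2 hu
  refine ⟨g, ?_, ?_⟩
  · rw [mul_inv_eq_iff_eq_mul]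
    apply Units.ext
    rw [Units.val_mul, Units.val_mul, hg, h1]
  · rw [mul_inv_eq_iff_eq_mul]
    apply Units.ext
    rw [Units.val_mul, Units.val_mul, hg, h2]

theorem conj_quat_mem_redNineThree (g : Gl 9) {q : Gl 9} (hq : q ∈ quatNine) :
    ∃ q' ∈ quatNine, redNineThree (g * q * g⁻¹) = redNineThree q' := by
  obtain ⟨h, hh, hgh⟩ := exists_mem_H9a (redNineThree g)
  exact ⟨h * q * h⁻¹, conj_mem_quatNine (H9a_le hh).1.1 (H9a_le hh).1.2 hq, by
    simp only [map_mul, map_inv, hgh]⟩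

theorem det_of_mem_quatNine {q : Gl 9} (hq : q ∈ quatNine) :
    Matrix.GeneralLinearGroup.det q = 1 := by
  have h : ∀ m ∈ quatList, m 0 0 * m 1 1 - m 0 1 * m 1 0 = 1 :=
    List.forall_mem_of_all _ _ (by decide +kernel)
  apply Units.ext
  rw [Matrix.GeneralLinearGroup.val_det_apply, Matrix.det_fin_two, h _ hq, Units.val_one]

/-- A conjugate of `q` by an element of `J` agrees modulo 3 with some `q'` in the quaternion group;
both have determinant one, so `hinj` makes them equal. Thus `J` normalizes `quatNine`. -/
theorem le_H9a_of_quat_mem (J : Subgroup (Gl 9))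
    (hinj : ∀ N ∈ J, redNineThree N = 1 → Matrix.GeneralLinearGroup.det N = 1 → N = 1)
    (hI : quatI ∈ J) (hJ : quatJ ∈ J) : J ≤ H9a := by
  have hle : quatNine ≤ J := by
    intro q hq
    exact (Subgroup.closure_le J).2 (by rintro x (rfl | rfl) <;> assumption)
      (mem_closure_of_mem_quatNine hq)
  have key : ∀ j ∈ J, ∀ q ∈ quatNine, j * q * j⁻¹ ∈ quatNine := by
    intro j hj q hq
    obtain ⟨q', hq', h⟩ := conj_quat_mem_redNineThree j hq
    have : j * q * j⁻¹ * q'⁻¹ = 1 := by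
      refine hinj _ (J.mul_mem (J.mul_mem (J.mul_mem hj (hle hq)) (J.inv_mem hj))
        (J.inv_mem (hle hq'))) ?_ ?_
      · rw [map_mul, h, map_inv, mul_inv_cancel]
      · simp [det_of_mem_quatNine hq, det_of_mem_quatNine hq']
    rw [mul_inv_eq_one.1 this]
    exact hq'
  rw [H9a_eq]
  intro j hj
  exact ⟨⟨key j hj _ quatI_mem, key j hj _ quatJ_mem⟩,
    key _ (J.inv_mem hj) _ quatI_mem, key _ (J.inv_mem hj) _ quatJ_mem⟩

theorem exists_lift_quat (J : Subgroup (Gl 9)) (h3 : J.map redNineThree = ⊤) {q : Gl 9}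
    (hq : q ∈ quatNine) : ∃ x ∈ J, redNineThree x = redNineThree q ∧
      Matrix.GeneralLinearGroup.det x = 1 := by
  obtain ⟨x, hx, hx'⟩ := Subgroup.exists_mem_of_map_eq_top h3 (redNineThree q)
  -- The ninth power fixes elements of order dividing 4 and kills determinants congruent to `1`
  -- modulo 3.
  refine ⟨x ^ 9, J.pow_mem hx _, ?_, ?_⟩
  · rw [map_pow, hx', ← map_pow, show q ^ 9 = q ^ 4 * q ^ 4 * q by group,
      pow_four_of_mem_quatNine hq, one_mul, one_mul]
  · have h1 : ∀ z : ZMod 9, ZMod.castHom (by decide : 3 ∣ 9) (ZMod 3) z = 1 → z ^ 9 = 1 := by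
      decide
    apply Units.ext
    rw [map_pow, Units.val_pow_eq_pow_val, h1, Units.val_one]
    rw [← det_redGl, hx', det_redGl, det_of_mem_quatNine hq, Units.val_one, map_one]

/-- The element `-x²` is trivial modulo 3, so its cube is `1`; its square is `x ^ 4 = 1` as well. -/
theorem sq_eq_neg_one (x q : Gl 9) (hx : redNineThree x = redNineThree q) (hx4 : x ^ 4 = 1)
    (hq : q * q = -1) : x.1 * x.1 = -1 := by
  have h3 : (-(x * x)) ^ 3 = 1 := by
    apply pow_three_of_redNineThree_eq_one
    have : -(x * x) = -1 * (x * x) := by rw [neg_one_mul]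
    rw [this, map_mul, map_mul, hx, ← map_mul, ← map_mul, hq]
    simp
  have h2 : (-(x * x)) ^ 2 = 1 := by
    rw [neg_sq, ← pow_two, ← pow_mul, hx4]
  rw [pow_succ, h2, one_mul] at h3
  rw [← Units.val_mul, ← neg_neg (x * x), h3]
  rfl

/-- A proper subgroup of `GL₂(ℤ/9ℤ)` with full determinant and full reduction modulo `3` lies in
a conjugate of `H9a`. -/
theorem conj_le_H9a (J : Subgroup (Gl 9)) (h3 : J.map redNineThree = ⊤)
    (hdet : J.map (Matrix.GeneralLinearGroup.det : Gl 9 →* (ZMod 9)ˣ) = ⊤) (htop : J ≠ ⊤) :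
    ∃ g : Gl 9, ∀ j ∈ J, g * j * g⁻¹ ∈ H9a := by
  have hinj : ∀ N ∈ J, redNineThree N = 1 → Matrix.GeneralLinearGroup.det N = 1 → N = 1 := by
    intro N hN h h'
    by_contra h1
    exact htop (eq_top_of_exists_mem_ker J h3 hdet N hN h h' h1)
  obtain ⟨x, hx, hxI, hxd⟩ := exists_lift_quat J h3 quatI_mem
  obtain ⟨y, hy, hyJ, hyd⟩ := exists_lift_quat J h3 quatJ_mem
  have hx4 : x ^ 4 = 1 := hinj _ (J.pow_mem hx _) (by
    rw [map_pow, hxI, ← map_pow, pow_four_of_mem_quatNine quatI_mem, map_one]) (by simp [hxd])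
  have hy4 : y ^ 4 = 1 := hinj _ (J.pow_mem hy _) (by
    rw [map_pow, hyJ, ← map_pow, pow_four_of_mem_quatNine quatJ_mem, map_one]) (by simp [hyd])
  have hyx : y * x * y⁻¹ * x = 1 := by
    refine hinj _ (J.mul_mem (J.mul_mem (J.mul_mem hy hx) (J.inv_mem hy)) hx) ?_
      (by simp [hxd, hyd])
    have : quatJ * quatI * quatJ⁻¹ * quatI = 1 := by
      apply Units.ext
      decide +kernel
    rw [map_mul, map_mul, map_mul, map_inv, hxI, hyJ, ← map_inv, ← map_mul, ← map_mul, ← map_mul,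
      this, map_one]
  have hx2 := sq_eq_neg_one x quatI hxI hx4 (Units.ext (by decide +kernel))
  have hy2 := sq_eq_neg_one y quatJ hyJ hy4 (Units.ext (by decide +kernel))
  obtain ⟨g, hgx, hgy⟩ := exists_conj_quat x y hxI hyJ hx2 hy2 (by
    have hx2' : x * x = -1 := Units.ext hx2
    have h : y * x = -(x * y) := by
      have e : x⁻¹ = -x := by rw [inv_eq_iff_mul_eq_one, mul_neg, hx2', neg_neg]
      rw [mul_eq_one_iff_eq_inv, mul_inv_eq_iff_eq_mul, e, neg_mul] at hyx
      exact hyx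
    exact Units.ext_iff.1 h)
  refine ⟨g, fun j hj => ?_⟩
  have := le_H9a_of_quat_mem (J.map (MulAut.conj g).toMonoidHom) (by
    rintro _ ⟨N, hN, rfl⟩ h h'
    have h1 : N = 1 := hinj N hN (by simpa using h) (by simpa using h')
    rw [h1, map_one]) ⟨x, hx, hgx⟩ ⟨y, hy, hgy⟩
  exact this ⟨j, hj, rfl⟩

/-! ### Homomorphisms onto `GL₂(ℤ/2ℤ)` -/

/-- An involution of `GL₂(ℤ/2ℤ)`. -/
def involTwoS : Gl 2 := ⟨!![0, 1; 1, 0], !![0, 1; 1, 0], by decide, by decide⟩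

/-- Another involution of `GL₂(ℤ/2ℤ)`. -/
def involTwoT : Gl 2 := ⟨!![1, 1; 0, 1], !![1, 1; 0, 1], by decide, by decide⟩

theorem gl_two_eq_word (g : Gl 2) : g = 1 ∨ g = involTwoS ∨ g = involTwoT ∨
    g = involTwoS * involTwoT ∨ g = involTwoT * involTwoS ∨
    g = involTwoS * (involTwoT * involTwoS) := by
  have := gl_two_decide (fun m => m = 1 ∨ m = involTwoS.1 ∨ m = involTwoT.1 ∨
      m = involTwoS.1 * involTwoT.1 ∨ m = involTwoT.1 * involTwoS.1 ∨
      m = involTwoS.1 * (involTwoT.1 * involTwoS.1)) (by decide +kernel) g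
  simpa only [Units.ext_iff, Units.val_mul, Units.val_one] using this

-- Every automorphism of `S₃` is inner. The last hypothesis forces `x` and `y` to be distinct
-- involutions, since the six words must exhaust the group.
set_option synthInstance.maxHeartbeats 400000 in
set_option synthInstance.maxSize 1000 in
theorem gl_two_exists_conj (x y : Gl 2) (hx : x * x = 1) (hy : y * y = 1)
    (h : ∀ z : Gl 2, z = 1 ∨ z = x ∨ z = y ∨ z = x * y ∨ z = y * x ∨ z = x * (y * x)) :
    ∃ s : Gl 2, s * involTwoS * s⁻¹ = x ∧ s * involTwoT * s⁻¹ = y := by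
  revert x y
  decide +kernel

/-- A nontrivial normal subgroup of `S₃` contains the 3-cycles; at most one product with a conjugate
is needed to reach the given one. -/
theorem gl_two_exists_word (z : Gl 2) (hz : z ≠ 1) :
    z = redFourTwo cubeRootFour ∨ ∃ g : Gl 2, z * (g * z * g⁻¹) = redFourTwo cubeRootFour := by
  revert z
  decide +kernel

/-- If `ψ` kills no less of `H` than `φ` does, they differ by an inner automorphism. -/
theorem exists_conj_of_ker_le {G : Type*} [Group G] (H : Subgroup G) (φ ψ : G →* Gl 2)
    (hφ : H.map φ = ⊤) (hψ : H.map ψ = ⊤) (hk : ∀ h ∈ H, ψ h = 1 → φ h = 1) :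
    ∃ s : Gl 2, ∀ h ∈ H, φ h = s * ψ h * s⁻¹ := by
  obtain ⟨a, ha, ha'⟩ := Subgroup.exists_mem_of_map_eq_top hψ involTwoS
  obtain ⟨b, hb, hb'⟩ := Subgroup.exists_mem_of_map_eq_top hψ involTwoT
  have heq : ∀ h ∈ H, ∀ k ∈ H, ψ h = ψ k → φ h = φ k := by
    intro h hh k hk' e
    have := hk (h * k⁻¹) (H.mul_mem hh (H.inv_mem hk')) (by rw [map_mul, map_inv, e, mul_inv_cancel])
    rwa [map_mul, map_inv, mul_inv_eq_one] at this
  have hS : involTwoS * involTwoS = 1 := Units.ext (by decide)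
  have hT : involTwoT * involTwoT = 1 := Units.ext (by decide)
  have hw : ∀ h ∈ H, (ψ h = 1 ∧ φ h = 1) ∨ (ψ h = involTwoS ∧ φ h = φ a) ∨
      (ψ h = involTwoT ∧ φ h = φ b) ∨ (ψ h = involTwoS * involTwoT ∧ φ h = φ a * φ b) ∨
      (ψ h = involTwoT * involTwoS ∧ φ h = φ b * φ a) ∨
      (ψ h = involTwoS * (involTwoT * involTwoS) ∧ φ h = φ a * (φ b * φ a)) := by
    intro h hh
    have hab := H.mul_mem ha hb
    have hba := H.mul_mem hb ha
    have haba := H.mul_mem ha hba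
    rcases gl_two_eq_word (ψ h) with e | e | e | e | e | e
    · exact Or.inl ⟨e, hk h hh e⟩
    · exact Or.inr (Or.inl ⟨e, heq h hh a ha (by rw [e, ha'])⟩)
    · exact Or.inr (Or.inr (Or.inl ⟨e, heq h hh b hb (by rw [e, hb'])⟩))
    · exact Or.inr (Or.inr (Or.inr (Or.inl ⟨e, by
        rw [← map_mul]; exact heq h hh _ hab (by rw [e, map_mul, ha', hb'])⟩)))
    · exact Or.inr (Or.inr (Or.inr (Or.inr (Or.inl ⟨e, by
        rw [← map_mul]; exact heq h hh _ hba (by rw [e, map_mul, ha', hb'])⟩))))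
    · exact Or.inr (Or.inr (Or.inr (Or.inr (Or.inr ⟨e, by
        rw [← map_mul, ← map_mul]
        exact heq h hh _ haba (by rw [e, map_mul, map_mul, ha', hb'])⟩))))
  obtain ⟨s, hs, ht⟩ := gl_two_exists_conj (φ a) (φ b)
    (by rw [← map_mul]; exact hk _ (H.mul_mem ha ha) (by rw [map_mul, ha', hS]))
    (by rw [← map_mul]; exact hk _ (H.mul_mem hb hb) (by rw [map_mul, hb', hT])) (by
      intro z
      obtain ⟨h, hh, rfl⟩ := Subgroup.exists_mem_of_map_eq_top hφ z
      rcases hw h hh with e | e | e | e | e | e <;> simp [e.2])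
  refine ⟨s, fun h hh => ?_⟩
  rcases hw h hh with e | e | e | e | e | e <;> rw [e.1, e.2]
  · group
  · rw [hs]
  · rw [ht]
  · rw [← hs, ← ht]; group
  · rw [← hs, ← ht]; group
  · rw [← hs, ← ht]; group

/-! ### Generation of `GL₂(ℤ/9ℤ)` by transvections -/

/-- Upper transvections. -/
def upperNine (x : ZMod 9) : Gl 9 := Gl.ofEntries 1 x 0 1 1 (by ring)

/-- Lower transvections. -/
def lowerNine (x : ZMod 9) : Gl 9 := Gl.ofEntries 1 0 x 1 1 (by ring)

/-- A diagonal matrix whose determinant generates `(ℤ/9ℤ)ˣ`. -/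
def diagNine : Gl 9 := Gl.ofEntries 1 0 0 2 5 (by decide)

theorem mem_of_isUnit (K : Subgroup (Gl 9)) [hK : K.Normal] (hU : ∀ x, upperNine x ∈ K)
    (hL : ∀ x, lowerNine x ∈ K) (g : Gl 9) (a' : ZMod 9) (ha : g.1 0 0 * a' = 1) :
    ∃ n : ℤ, g * diagNine ^ n ∈ K := by
  have h2 : ∀ u v : ZMod 9, u * v = 1 → ∃ n : Fin 6, u = 2 ^ n.1 := by decide
  have hdiag : ∀ n : ℕ, (diagNine ^ n).1 = !![1, 0; 0, 2 ^ n] := by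
    intro n
    induction n with
    | zero => simp [Matrix.one_fin_two]
    | succ n ih =>
      rw [pow_succ, Units.val_mul, ih]
      ext i j
      fin_cases i <;> fin_cases j <;> simp [diagNine, Matrix.mul_apply, pow_succ]
  obtain ⟨e, he⟩ := isUnit_iff_exists_inv.1 ((Matrix.isUnit_iff_isUnit_det g.1).1 g.isUnit)
  obtain ⟨n, hn⟩ := h2 _ e he
  rw [Matrix.det_fin_two] at hn
  -- The part in parentheses is Whitehead's expression of `diag(a, a')` as a product of
  -- transvections, `a` being the top left entry.
  set A := lowerNine (g.1 1 0 * a') * (upperNine (g.1 0 0) * lowerNine (-a') *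
    upperNine (g.1 0 0) * (upperNine (-1) * lowerNine 1 * upperNine (-1))) with hA
  have hAK : A ∈ K := K.mul_mem (hL _) (K.mul_mem (K.mul_mem (K.mul_mem (hU _) (hL _)) (hU _))
    (K.mul_mem (K.mul_mem (hU _) (hL _)) (hU _)))
  have hg : g = A * diagNine ^ n.1 * upperNine (g.1 0 1 * a') := by
    apply Units.ext
    rw [Units.val_mul, Units.val_mul, hdiag, ← hn]
    have hAm : A.1 = !![g.1 0 0, 0; g.1 1 0, a'] := by
      simp only [hA, Units.val_mul, lowerNine, upperNine, Gl.val_ofEntries, Matrix.mul_fin_two]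
      ext i j
      fin_cases i <;> fin_cases j <;> simp
      · linear_combination (-g.1 0 0) * ha
      · linear_combination ha
      · linear_combination (g.1 1 0 - g.1 0 0 * a' * g.1 1 0 - 1) * ha
      · linear_combination (a' * g.1 1 0) * ha
    rw [hAm]
    conv_lhs => rw [Matrix.eta_fin_two g.1]
    simp only [upperNine, Gl.val_ofEntries, Matrix.mul_fin_two]
    ext i j
    fin_cases i <;> fin_cases j <;> simp
    · linear_combination (-g.1 0 1) * ha
    · linear_combination (-g.1 1 1) * ha
  refine ⟨-n.1, ?_⟩
  rw [hg, zpow_neg, zpow_natCast, mul_assoc A, mul_assoc A]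
  exact K.mul_mem hAK (hK.conj_mem _ (hU _) _)

/-- A normal subgroup of `GL₂(ℤ/9ℤ)` containing the transvections has cyclic quotient. -/
theorem exists_zpow_diagNine (K : Subgroup (Gl 9)) [K.Normal] (hU : ∀ x, upperNine x ∈ K)
    (hL : ∀ x, lowerNine x ∈ K) (g : Gl 9) : ∃ n : ℤ, g * diagNine ^ n ∈ K := by
  -- As `ℤ/9ℤ` is local, the determinant would be a non-unit if both `a` and `a + c` were; one row
  -- operation reduces the second case to `mem_of_isUnit`.
  have h1 : ∀ a b c d e : ZMod 9, (a * d - b * c) * e = 1 →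
      (∃ a', a * a' = 1) ∨ ∃ a', (a + c) * a' = 1 := by
    have h2 : ∀ x : ZMod 9, 3 * x ≠ 0 → ∃ y, x * y = 1 := by decide
    have h3 : ∀ x : ZMod 9, 3 * x = 0 → ∃ y, x = 3 * y := by decide
    intro a b c d e h
    by_cases ha : 3 * a = 0
    · right
      by_cases hc : 3 * (a + c) = 0
      · exfalso
        have h4 : (3 : ZMod 9) * ((a * d - b * c) * e) = 0 := by
          linear_combination (d * e + b * e) * ha - b * e * hc
        rw [h] at h4
        exact absurd h4 (by decide)
      · exact h2 _ hc
    · exact Or.inl (h2 _ ha)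
  have := Gl.forall_of_entries (fun m => (∃ a', m 0 0 * a' = 1) ∨ ∃ a', (m 0 0 + m 1 0) * a' = 1)
    (fun a b c d e h => h1 a b c d e h) g
  rcases this with ⟨a', h⟩ | ⟨a', h⟩
  · exact mem_of_isUnit K hU hL g a' h
  · obtain ⟨n, hn⟩ := mem_of_isUnit K hU hL (upperNine 1 * g) a' (by
      rw [Units.val_mul, Matrix.mul_apply, Fin.sum_univ_two]
      simpa [upperNine] using h)
    refine ⟨n, ?_⟩
    have := K.mul_mem (K.inv_mem (hU 1)) hn
    simpa [mul_assoc] using this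

theorem upperNine_pow (x : ZMod 9) : upperNine x ^ 9 = 1 := by
  apply Units.ext
  rw [Units.val_pow_eq_pow_val]
  revert x
  change ∀ x : ZMod 9, !![1, x; 0, 1] ^ 9 = (1 : Matrix (Fin 2) (Fin 2) (ZMod 9))
  decide +kernel

theorem lowerNine_pow (x : ZMod 9) : lowerNine x ^ 9 = 1 := by
  apply Units.ext
  rw [Units.val_pow_eq_pow_val]
  revert x
  change ∀ x : ZMod 9, !![1, 0; x, 1] ^ 9 = (1 : Matrix (Fin 2) (Fin 2) (ZMod 9))
  decide +kernel

/-! ### Subgroups of `GL₂(ℤ/36ℤ)` with full reductions modulo `4` and modulo `9` -/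

theorem eq_commutator_kleinFour :
    cubeRootFour * (Gl.ofEntries 0 1 1 0 (-1) (by decide) * cubeRootFour *
      (Gl.ofEntries 0 1 1 0 (-1) (by decide))⁻¹) * cubeRootFour⁻¹ *
      (Gl.ofEntries 0 1 1 0 (-1) (by decide) * cubeRootFour *
      (Gl.ofEntries 0 1 1 0 (-1) (by decide))⁻¹)⁻¹ = kleinFour := by
  apply Units.ext
  decide +kernel

theorem conj_cubeRootFour_mem (K : Subgroup (Gl 4)) [hK : K.Normal] (hv : kleinFour ∈ K)
    (c : Gl 4) : c * cubeRootFour * c⁻¹ * cubeRootFour⁻¹ ∈ K ∨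
      c * cubeRootFour * c⁻¹ * cubeRootFour ∈ K := by
  -- The conjugate of `cubeRootFour` is an element of the Klein four-group times `cubeRootFour` or
  -- its square: `i` and `j` encode the Klein element, `l` the exponent.
  have hw : ∃ (i : Fin 3) (j : Fin 2) (l : Fin 2), c * cubeRootFour =
      cubeRootFour ^ i.1 * kleinFour ^ j.1 * cubeRootFour ^ (3 - i.1) *
        cubeRootFour ^ (l.1 + 1) * c := by
    have := gl_four_decide (fun m => ∃ (i : Fin 3) (j : Fin 2) (l : Fin 2),
      m * !![1, 1; 1, 2] = !![1, 1; 1, 2] ^ i.1 * !![1, 2; 2, 1] ^ j.1 *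
        !![1, 1; 1, 2] ^ (3 - i.1) * !![1, 1; 1, 2] ^ (l.1 + 1) * m) (by decide +kernel) c
    simp only [Units.ext_iff, Units.val_mul, Units.val_pow_eq_pow_val]
    exact this
  obtain ⟨i, j, l, h⟩ := hw
  have hi : cubeRootFour ^ (3 - i.1) = (cubeRootFour ^ i.1)⁻¹ := by
    rw [eq_inv_iff_mul_eq_one, ← pow_add, Nat.sub_add_cancel i.2.le, cubeRootFour_pow_three]
  have hm : c * cubeRootFour * c⁻¹ * (cubeRootFour ^ (l.1 + 1))⁻¹ ∈ K := by
    rw [h, mul_inv_cancel_right, mul_inv_cancel_right, hi]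
    exact hK.conj_mem _ (K.pow_mem hv _) _
  have hl : l = 0 ∨ l = 1 := by omega
  rcases hl with rfl | rfl
  · left
    simpa using hm
  · right
    have h2 : (cubeRootFour ^ 2)⁻¹ = cubeRootFour := by rw [← cubeRootFour_inv, inv_inv]
    change c * cubeRootFour * c⁻¹ * (cubeRootFour ^ 2)⁻¹ ∈ K at hm
    rwa [h2] at hm

/-- If every conjugate of `p` is `p` or `p⁻¹` modulo a normal subgroup, with `p⁻¹` occurring, then
`p` lies in this subgroup. -/
theorem mem_of_conj_mem (K : Subgroup (Gl 9)) [hK : K.Normal] (p : Gl 9)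
    (hp : redNineThree p = 1) (h : ∀ g : Gl 9, g * p * g⁻¹ * p⁻¹ ∈ K ∨ g * p * g⁻¹ * p ∈ K)
    (h' : ∃ g : Gl 9, g * p * g⁻¹ * p ∈ K) : p ∈ K := by
  let π := QuotientGroup.mk' K
  have hπ : ∀ {x : Gl 9}, π x = 1 ↔ x ∈ K := by
    intro x
    rw [← MonoidHom.mem_ker, QuotientGroup.ker_mk']
  have hsq : ∀ g : Gl 9, π (g ^ 2 * p * (g ^ 2)⁻¹) = π p := by
    intro g
    have e : g ^ 2 * p * (g ^ 2)⁻¹ = g * (g * p * g⁻¹) * g⁻¹ := by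
      rw [pow_two, mul_inv_rev]
      simp only [mul_assoc]
    rcases h g with hg | hg
    · have e1 : π (g * p * g⁻¹) = π p := by
        rw [← hπ, map_mul, map_inv, mul_inv_eq_one] at hg
        exact hg
      rw [e, map_mul, map_mul, e1, ← map_mul, ← map_mul, e1]
    · have e1 : π (g * p * g⁻¹) = (π p)⁻¹ := by
        rw [← hπ, map_mul, mul_eq_one_iff_eq_inv] at hg
        exact hg
      rw [e, map_mul, map_mul, e1, ← map_inv, ← map_mul, ← map_mul,
        show g * p⁻¹ * g⁻¹ = (g * p * g⁻¹)⁻¹ by group, map_inv, e1, inv_inv]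
  -- The squares of `a`, `b`, `c` reduce modulo 3 to `i`, `j`, `k` in the quaternion group, so `z`
  -- is the average of `p` over that group modulo sign and is scalar. Squares fix `p` modulo `K`, so
  -- `z` has the class of `p ^ 4 = p`. Centrality of `z` and an inverting `g` then give `p² ∈ K`.
  let a : Gl 9 := Gl.ofEntries 1 2 1 1 (-1) (by decide)
  let b : Gl 9 := Gl.ofEntries 1 1 1 0 (-1) (by decide)
  let c : Gl 9 := Gl.ofEntries 0 1 1 1 (-1) (by decide)
  obtain ⟨z, hz⟩ : ∃ z, z = p * (a ^ 2 * p * (a ^ 2)⁻¹) * (b ^ 2 * p * (b ^ 2)⁻¹) *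
    (c ^ 2 * p * (c ^ 2)⁻¹) := ⟨_, rfl⟩
  have hp3 := pow_three_of_redNineThree_eq_one hp
  have hπz : π z = π p := by
    rw [hz, map_mul, map_mul, map_mul, hsq, hsq, hsq, ← map_mul, ← map_mul, ← map_mul,
      show p * p * p * p = p ^ 3 * p by rw [pow_succ, pow_two], hp3, one_mul]
  have hcent : ∀ g : Gl 9, g * z * g⁻¹ = z := by
    have key := gl_nine_ker_decide (fun m => ∃ x : ZMod 9,
      m * (!![1, 2; 1, 1] ^ 2 * m * !![-1, 2; 1, -1] ^ 2) *
        (!![1, 1; 1, 0] ^ 2 * m * !![0, 1; 1, -1] ^ 2) *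
        (!![0, 1; 1, 1] ^ 2 * m * !![-1, 1; 1, 0] ^ 2) = !![x, 0; 0, x]) (by decide +kernel) p hp
    obtain ⟨x, hx⟩ := key
    have ha : (a ^ 2)⁻¹.1 = !![-1, 2; 1, -1] ^ 2 := by decide +kernel
    have hb : (b ^ 2)⁻¹.1 = !![0, 1; 1, -1] ^ 2 := by decide +kernel
    have hc : (c ^ 2)⁻¹.1 = !![-1, 1; 1, 0] ^ 2 := by decide +kernel
    have hzx : z.1 = !![x, 0; 0, x] := by
      simp only [hz, Units.val_mul, ha, hb, hc, Units.val_pow_eq_pow_val]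
      exact hx
    intro g
    rw [mul_inv_eq_iff_eq_mul]
    apply Units.ext
    rw [Units.val_mul, Units.val_mul, hzx]
    ext i j
    fin_cases i <;> fin_cases j <;> simp [Matrix.mul_apply, mul_comm]
  obtain ⟨g, hg⟩ := h'
  have e1 : π (g * p * g⁻¹) = π p := by
    rw [map_mul, map_mul, ← hπz, ← map_mul, ← map_mul, hcent]
  rw [← hπ, map_mul, e1, ← map_mul, ← pow_two, hπ] at hg
  have : p = p ^ 3 * (p ^ 2)⁻¹ := by group
  rw [this, hp3, one_mul]
  exact K.inv_mem hg

/-- The exponent of `GL₂(ℤ/4ℤ)` divides 24, so `b ^ 8` is trivial or conjugate to `cubeRootFour`. -/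
theorem pow_eight_mem (K : Subgroup (Gl 4)) [hK : K.Normal] (ht : cubeRootFour ∈ K) (b : Gl 4) :
    b ^ 8 ∈ K := by
  by_cases h1 : b ^ 8 = 1
  · rw [h1]
    exact K.one_mem
  · have h3 : (b ^ 8) ^ 3 = 1 := by
      apply Units.ext
      rw [Units.val_pow_eq_pow_val, Units.val_pow_eq_pow_val]
      exact gl_four_decide (fun m => (m ^ 8) ^ 3 = 1) (by decide +kernel) b
    obtain ⟨g, hg⟩ := exists_conj_cubeRootFour _ h3 h1
    have := hK.conj_mem _ ht g⁻¹
    rw [← hg] at this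
    simpa [mul_assoc] using this

/-- The element `h` is used to enlarge the slices until the slice modulo 9 contains all
transvections. Both quotients are then cyclic, and commutators of each factor lift to `[H, H]`
independently. -/
theorem commutator_le_of_cubeRootFour (H : Subgroup (Gl 36)) (h4 : H.map redFour = ⊤)
    (h9 : H.map redNine = ⊤) (h : Gl 36) (hh : h ∈ H) (ht : redFour h = cubeRootFour)
    (hp : redNineThree (redNine h) = 1) :
    ⁅(⊤ : Subgroup (Gl 36)), (⊤ : Subgroup (Gl 36))⁆ ≤ ⁅H, H⁆ := by
  have hK1 : (sliceLeft redFour redNine H).Normal := sliceLeft_normal h4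
  have hK2 : (sliceLeft redNine redFour H).Normal := sliceLeft_normal h9
  -- Modulo 9 the element `h` and its conjugate lie in the abelian kernel, so their commutator is
  -- trivial there, while modulo 4 it is `kleinFour`.
  have hv : kleinFour ∈ sliceLeft redFour redNine H := by
    obtain ⟨y, hy, hy'⟩ := Subgroup.exists_mem_of_map_eq_top h4
      (Gl.ofEntries 0 1 1 0 (-1) (by decide))
    have hyc : y * h * y⁻¹ ∈ H := H.mul_mem (H.mul_mem hy hh) (H.inv_mem hy)
    refine mem_sliceLeft.2 ⟨h * (y * h * y⁻¹) * h⁻¹ * (y * h * y⁻¹)⁻¹,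
      H.mul_mem (H.mul_mem (H.mul_mem hh hyc) (H.inv_mem hh)) (H.inv_mem hyc), ?_, ?_⟩
    · simp only [map_mul, map_inv, ht, hy', ← eq_commutator_kleinFour]
    · have hc : Commute (redNine h) (redNine (y * h * y⁻¹)) := by
        apply commute_of_redNineThree_eq_one hp
        rw [map_mul, map_mul, map_mul, map_mul, hp, mul_one, ← map_mul, ← map_mul, mul_inv_cancel,
          map_one, map_one]
      rw [map_mul, map_mul, map_mul, hc.eq, map_inv, map_inv, mul_inv_cancel_right, mul_inv_cancel]
  -- Conjugation fixes or inverts `h` modulo 4 up to the slice, hence does the same to `redNine h`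
  -- up to the other slice; the matrix `(0, 1; 3, 0)` supplies an inversion.
  have hp2 : redNine h ∈ sliceLeft redNine redFour H := by
    have key : ∀ y ∈ H, ∀ x ∈ H, redFour (y * h * y⁻¹ * x) ∈ sliceLeft redFour redNine H →
        redNine y * redNine h * (redNine y)⁻¹ * redNine x ∈ sliceLeft redNine redFour H := by
      intro y hy x hx hm
      have := mem_slice_of_mem_slice (p := redNine) (q := redFour) _
        (H.mul_mem (H.mul_mem (H.mul_mem hy hh) (H.inv_mem hy)) hx) hm
      simpa only [map_mul, map_inv] using this
    apply mem_of_conj_mem _ _ hp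
    · intro g
      obtain ⟨y, hy, rfl⟩ := Subgroup.exists_mem_of_map_eq_top h9 g
      rcases conj_cubeRootFour_mem _ hv (redFour y) with hc | hc
      · left
        rw [← map_inv redNine h]
        exact key y hy _ (H.inv_mem hh) (by simpa only [map_mul, map_inv, ht] using hc)
      · right
        exact key y hy _ hh (by simpa only [map_mul, map_inv, ht] using hc)
    · obtain ⟨y, hy, hy'⟩ := Subgroup.exists_mem_of_map_eq_top h4
        (Gl.ofEntries 0 1 3 0 1 (by decide))
      refine ⟨redNine y, key y hy _ hh ?_⟩
      have : Gl.ofEntries 0 1 3 0 1 (by decide) * cubeRootFour *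
          (Gl.ofEntries 0 1 3 0 1 (by decide))⁻¹ * cubeRootFour = 1 := by
        apply Units.ext
        decide +kernel
      simp only [map_mul, map_inv, ht, hy', this]
      exact Subgroup.one_mem _
  have ht1 : cubeRootFour ∈ sliceLeft redFour redNine H := by
    rw [← ht]
    exact mem_slice_of_mem_slice h hh hp2
  -- If `y` lies over `u`, then `y ^ 9` is trivial modulo 9, and eighth powers modulo 4 are in the
  -- slice; hence so is `redFour y`.
  have hu : ∀ u : Gl 9, u ^ 9 = 1 → u ∈ sliceLeft redNine redFour H := by
    intro u hu
    obtain ⟨y, hy, rfl⟩ := Subgroup.exists_mem_of_map_eq_top h9 u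
    apply mem_slice_of_mem_slice y hy
    have hy9 : redFour y ^ 9 ∈ sliceLeft redFour redNine H :=
      mem_sliceLeft.2 ⟨y ^ 9, H.pow_mem hy _, map_pow _ _ _, by rw [map_pow, hu]⟩
    have : redFour y = redFour y ^ 9 * (redFour y ^ 8)⁻¹ := by group
    rw [this]
    exact Subgroup.mul_mem _ hy9 (Subgroup.inv_mem _ (pow_eight_mem _ ht1 _))
  have hc2 : ∃ c, ∀ g, ∃ n : ℤ, g * c ^ n ∈ sliceLeft redNine redFour H :=
    ⟨diagNine, exists_zpow_diagNine _ (fun x => hu _ (upperNine_pow x))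
      (fun x => hu _ (lowerNine_pow x))⟩
  have hc1 := cyclic_slice h4 h9 hc2
  intro g hg
  have hmap : ∀ {M : Type} [Group M] (f : Gl 36 →* M),
      f g ∈ ⁅(⊤ : Subgroup M), (⊤ : Subgroup M)⁆ := by
    intro M _ f
    have := Subgroup.mem_map_of_mem f hg
    rw [Subgroup.map_commutator] at this
    exact Subgroup.commutator_mono le_top le_top this
  obtain ⟨x, hx, hx1, hx2⟩ := exists_mem_commutator h4 hc1 _ (hmap redFour)
  obtain ⟨y, hy, hy1, hy2⟩ := exists_mem_commutator h9 hc2 _ (hmap redNine)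
  have : g = x * y := gl_thirtySix_ext (by rw [map_mul, hx1, hy2, mul_one])
    (by rw [map_mul, hx2, hy1, one_mul])
  rw [this]
  exact Subgroup.mul_mem _ hx hy

theorem pow_four_of_mem_calN {g : Gl 3} (hg : g ∈ calN) : g ^ 4 = 1 := by
  apply Units.ext
  rw [Units.val_pow_eq_pow_val, Units.val_one]
  rcases hg with ⟨x, y, hxy, h⟩ | ⟨x, y, hxy, h⟩
  · rw [h]
    revert x y
    have : ∀ x y : ZMod 3, x ^ 2 + y ^ 2 = 1 → !![x, -y; y, x] ^ 4 = 1 := by decide +kernel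
    exact fun x y h _ => this x y h
  · rw [h]
    revert x y
    have : ∀ x y : ZMod 3, x ^ 2 + y ^ 2 = -1 → !![x, y; y, -x] ^ 4 = 1 := by decide +kernel
    exact fun x y h _ => this x y h

/-- A subgroup with full reductions modulo `4` and `9` and with a small commutator subgroup is, up
to conjugation, entangled by `θ`. -/
theorem exists_conj_theta (θ : Gl 3 →* Gl 2) (hθ : IsTheta θ) (H : Subgroup (Gl 36))
    (h4 : H.map redFour = ⊤) (h9 : H.map redNine = ⊤)
    (hc : ¬ ⁅(⊤ : Subgroup (Gl 36)), (⊤ : Subgroup (Gl 36))⁆ ≤ ⁅H, H⁆) :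
    ∃ s : Gl 2, ∀ h ∈ H, redFourTwo (redFour h) = s * θ (redNineThree (redNine h)) * s⁻¹ := by
  have hφ : H.map (redFourTwo.comp redFour) = ⊤ := by
    rw [← Subgroup.map_map, h4, Subgroup.map_top_of_surjective]
    exact fun g => (exists_lift_four g 1).imp fun _ h => h.1
  have hψ : H.map ((θ.comp redNineThree).comp redNine) = ⊤ := by
    rw [← Subgroup.map_map, h9, Subgroup.map_top_of_surjective]
    exact hθ.1.comp exists_lift_nine
  refine exists_conj_of_ker_le H (redFourTwo.comp redFour) ((θ.comp redNineThree).comp redNine)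
    hφ hψ fun h hh hψh => ?_
  by_contra hφh
  apply hc
  -- An element killed by `θ` but not modulo 2 yields one whose reduction modulo 2 is the chosen
  -- 3-cycle. Elements of `calN` have order dividing 4, so its fourth power is trivial modulo 3.
  have hex : ∃ k ∈ H, redFourTwo (redFour k) = redFourTwo cubeRootFour ∧
      θ (redNineThree (redNine k)) = 1 := by
    rcases gl_two_exists_word _ hφh with e | ⟨g, e⟩
    · exact ⟨h, hh, e, hψh⟩
    · obtain ⟨y, hy, rfl⟩ := Subgroup.exists_mem_of_map_eq_top hφ g
      refine ⟨h * (y * h * y⁻¹), H.mul_mem hh (H.mul_mem (H.mul_mem hy hh) (H.inv_mem hy)), ?_, ?_⟩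
      · rw [← e]
        simp
      · have hψh' : θ (redNineThree (redNine h)) = 1 := hψh
        simp [hψh']
  obtain ⟨k, hk, hk4, hk9⟩ := hex
  have hN : redNineThree (redNine k) ∈ calN := by
    rw [← hθ.2]
    exact hk9
  obtain ⟨g, hg⟩ := exists_conj_cubeRootFour _ (pow_four_of_redGl_eq _ hk4).1
    (pow_four_of_redGl_eq _ hk4).2
  obtain ⟨y, hy, rfl⟩ := Subgroup.exists_mem_of_map_eq_top h4 g
  refine commutator_le_of_cubeRootFour H h4 h9 (y * k ^ 4 * y⁻¹)
    (H.mul_mem (H.mul_mem hy (H.pow_mem hk _)) (H.inv_mem hy)) (by simpa using hg) ?_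
  simp only [map_mul, map_pow, pow_four_of_mem_calN hN, map_inv, mul_one, mul_inv_cancel]

/-! ### Membership in `G36` -/

theorem mem_G36_iff {H : Subgroup (Gl 36)} : H ∈ G36 ↔
    (∀ g, ∃ x ∈ H, redFourTwo (redFour x) = g) ∧ (∀ g, ∃ x ∈ H, redNineThree (redNine x) = g) ∧
    (∀ u, ∃ x ∈ H, Matrix.GeneralLinearGroup.det x = u) ∧
    ∃ x ∈ ⁅(⊤ : Subgroup (Gl 36)), (⊤ : Subgroup (Gl 36))⁆, x ∉ ⁅H, H⁆ := by
  have htop : ∀ {M : Type} [Group M] (f : Gl 36 →* M), H.map f = ⊤ ↔ ∀ g, ∃ x ∈ H, f x = g := by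
    intro M _ f
    rw [eq_top_iff]
    exact ⟨fun h g => h (Subgroup.mem_top g), fun h g _ => h g⟩
  have h2 : ∀ x : Gl 36, redGl (by decide : 2 ∣ 36) x = redFourTwo (redFour x) :=
    fun x => (redGl_redGl _ _ _ x).symm
  have h3 : ∀ x : Gl 36, redGl (by decide : 3 ∣ 36) x = redNineThree (redNine x) :=
    fun x => (redGl_redGl _ _ _ x).symm
  simp only [G36, Set.mem_ofPred_eq, htop, h2, h3, lt_iff_le_not_ge, SetLike.not_le_iff_exists]
  simp only [Subgroup.commutator_mono (le_top : H ≤ ⊤) (le_top : H ≤ ⊤), true_and]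

theorem exists_commutator_not_mem {G A : Type*} [Group G] [Group A] (p : G →* A)
    (hp : Function.Surjective p) (K : Subgroup A)
    (h : ∃ x ∈ ⁅(⊤ : Subgroup A), (⊤ : Subgroup A)⁆, x ∉ ⁅K, K⁆) :
    ∃ x ∈ ⁅(⊤ : Subgroup G), (⊤ : Subgroup G)⁆, x ∉ ⁅K.comap p, K.comap p⁆ := by
  obtain ⟨x, hx, hx'⟩ := h
  rw [← Subgroup.map_top_of_surjective p hp, ← Subgroup.map_commutator] at hx
  obtain ⟨y, hy, rfl⟩ := hx
  refine ⟨y, hy, fun h => hx' ?_⟩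
  have := Subgroup.mem_map_of_mem p h
  rw [Subgroup.map_commutator] at this
  exact Subgroup.commutator_mono (Subgroup.map_comap_le _ _) (Subgroup.map_comap_le _ _) this

theorem not_mem_commutator {G : Type*} [Group G] {K : Subgroup G} {x : G} (hx : x ∉ K) :
    x ∉ ⁅K, K⁆ := fun h => hx (by
  have : ⁅K, K⁆ ≤ K := Subgroup.commutator_le.2 fun a ha b hb =>
    K.mul_mem (K.mul_mem (K.mul_mem ha hb) (K.inv_mem ha)) (K.inv_mem hb)
  exact this h)

theorem mul_mem_commutator_top {G : Type*} [Group G] (a b : G) :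
    a * b * a⁻¹ * b⁻¹ ∈ ⁅(⊤ : Subgroup G), (⊤ : Subgroup G)⁆ :=
  Subgroup.commutator_mem_commutator (Subgroup.mem_top a) (Subgroup.mem_top b)

theorem redFour_surjective : Function.Surjective redFour :=
  fun g => (exists_gl_thirtySix g 1).imp fun _ h => h.1

theorem redNine_surjective : Function.Surjective redNine :=
  fun g => (exists_gl_thirtySix 1 g).imp fun _ h => h.2

theorem det_thirtySix_ext {x : Gl 36} {u : (ZMod 36)ˣ}
    (h4 : Matrix.GeneralLinearGroup.det (redFour x) =
      Units.map (ZMod.castHom (by decide : 4 ∣ 36) (ZMod 4)).toMonoidHom u)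
    (h9 : Matrix.GeneralLinearGroup.det (redNine x) =
      Units.map (ZMod.castHom (by decide : 9 ∣ 36) (ZMod 9)).toMonoidHom u) :
    Matrix.GeneralLinearGroup.det x = u := by
  apply Units.ext
  apply zmod_thirtySix_ext
  · rw [← det_redGl, h4]; rfl
  · rw [← det_redGl, h9]; rfl

theorem exists_det_nine (u : (ZMod 9)ˣ) : ∃ g : Gl 9, Matrix.GeneralLinearGroup.det g = u :=
  ⟨Gl.ofEntries 1 0 0 u (u⁻¹ : (ZMod 9)ˣ) (by simp), by
    apply Units.ext
    rw [Matrix.GeneralLinearGroup.val_det_apply, Gl.val_ofEntries, Matrix.det_fin_two_of]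
    ring⟩

theorem comap_redFour_mem_G36 (K : Subgroup (Gl 4)) (h2 : ∀ g, ∃ x ∈ K, redFourTwo x = g)
    (hdet : ∀ u, ∃ x ∈ K, Matrix.GeneralLinearGroup.det x = u)
    (hc : ∃ x ∈ ⁅(⊤ : Subgroup (Gl 4)), (⊤ : Subgroup (Gl 4))⁆, x ∉ ⁅K, K⁆) :
    K.comap redFour ∈ G36 := by
  refine mem_G36_iff.2 ⟨fun g => ?_, fun g => ?_, fun u => ?_,
    exists_commutator_not_mem redFour redFour_surjective K hc⟩
  · obtain ⟨k, hk, rfl⟩ := h2 g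
    obtain ⟨x, rfl⟩ := redFour_surjective k
    exact ⟨x, hk, rfl⟩
  · obtain ⟨y, rfl⟩ := exists_lift_nine g
    obtain ⟨x, hx4, rfl⟩ := exists_gl_thirtySix 1 y
    exact ⟨x, by rw [Subgroup.mem_comap, hx4]; exact K.one_mem, rfl⟩
  · obtain ⟨k, hk, hk'⟩ := hdet (Units.map _ u)
    obtain ⟨y, hy⟩ := exists_det_nine (Units.map _ u)
    obtain ⟨x, rfl, rfl⟩ := exists_gl_thirtySix k y
    exact ⟨x, hk, det_thirtySix_ext hk' hy⟩

theorem comap_redNine_mem_G36 (K : Subgroup (Gl 9)) (h3 : ∀ g, ∃ x ∈ K, redNineThree x = g)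
    (hdet : ∀ u, ∃ x ∈ K, Matrix.GeneralLinearGroup.det x = u)
    (hc : ∃ x ∈ ⁅(⊤ : Subgroup (Gl 9)), (⊤ : Subgroup (Gl 9))⁆, x ∉ ⁅K, K⁆) :
    K.comap redNine ∈ G36 := by
  refine mem_G36_iff.2 ⟨fun g => ?_, fun g => ?_, fun u => ?_,
    exists_commutator_not_mem redNine redNine_surjective K hc⟩
  · obtain ⟨y, rfl, -⟩ := exists_lift_four g 1
    obtain ⟨x, rfl, hx9⟩ := exists_gl_thirtySix y 1
    exact ⟨x, by rw [Subgroup.mem_comap, hx9]; exact K.one_mem, rfl⟩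
  · obtain ⟨k, hk, rfl⟩ := h3 g
    obtain ⟨x, rfl⟩ := redNine_surjective k
    exact ⟨x, hk, rfl⟩
  · obtain ⟨k, hk, hk'⟩ := hdet (Units.map _ u)
    obtain ⟨y, -, hy⟩ := exists_lift_four 1 (Units.map _ u)
    obtain ⟨x, rfl, rfl⟩ := exists_gl_thirtySix y k
    exact ⟨x, hk, det_thirtySix_ext hy hk'⟩

theorem mem_H4a {g : Gl 4} : g ∈ H4a ↔ Matrix.GeneralLinearGroup.det g =
    Units.map (Int.castRingHom (ZMod 4)).toMonoidHom (epsilonGl (redFourTwo g)) := Iff.rfl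

/-- The matrices of the subgroup of `GL₂(ℤ/4ℤ)` generated by the elements of order three. -/
def tetraList : List (Matrix (Fin 2) (Fin 2) (ZMod 4)) :=
  [1, !![1, 1; 1, 2], !![2, 3; 3, 1], !![1, 2; 2, 1], !![3, 2; 0, 3], !![3, 0; 2, 3],
    !![0, 3; 1, 3], !![0, 1; 3, 3], !![3, 3; 1, 0], !![3, 1; 3, 0], !![1, 3; 3, 2],
    !![2, 1; 1, 1]]

theorem tetraList_mul : ∀ m ∈ tetraList, ∀ m' ∈ tetraList, m * m' ∈ tetraList := by
  have := List.forall_mem_of_all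
    (fun m => (tetraList.all fun m' => decide (m * m' ∈ tetraList)) = true)
    tetraList (by decide +kernel)
  exact fun m hm => List.forall_mem_of_all _ tetraList (this m hm)

theorem tetraList_inv : ∀ m ∈ tetraList, m ^ 5 ∈ tetraList ∧ m ^ 6 = 1 :=
  List.forall_mem_of_all _ _ (by decide +kernel)

/-- The subgroup of `GL₂(ℤ/4ℤ)` generated by the elements of order three. -/
def tetraFour : Subgroup (Gl 4) where
  carrier := {g | g.1 ∈ tetraList}
  one_mem' := by
    change (1 : Matrix (Fin 2) (Fin 2) (ZMod 4)) ∈ tetraList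
    decide
  mul_mem' {a b} ha hb := tetraList_mul _ ha _ hb
  inv_mem' {a} ha := by
    have h := tetraList_inv _ ha
    have h6 : a ^ 6 = 1 := Units.ext (by rw [Units.val_pow_eq_pow_val, h.2, Units.val_one])
    have h5 : a⁻¹ = a ^ 5 := by rw [inv_eq_iff_mul_eq_one, ← pow_succ', h6]
    change a⁻¹.1 ∈ tetraList
    rw [h5, Units.val_pow_eq_pow_val]
    exact h.1

instance tetraFour_normal : tetraFour.Normal := by
  constructor
  intro n hn g
  have key := gl_four_decide (fun m => (tetraList.all fun a =>
    tetraList.any fun b => decide (m * a = b * m)) = true) (by decide +kernel) g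
  simp only [List.all_eq_true, List.any_eq_true, decide_eq_true_eq] at key
  obtain ⟨b, hb, h⟩ := key n.1 hn
  change (g * n * g⁻¹).1 ∈ tetraList
  rw [Units.val_mul, Units.val_mul, h, mul_assoc, ← Units.val_mul, mul_inv_cancel, Units.val_one,
    mul_one]
  exact hb

/-- The permutation matrix of the transposition. -/
def swapFour : Gl 4 := Gl.ofEntries 0 1 1 0 (-1) (by decide)

theorem exists_eq_of_mem_H4a {g : Gl 4} (hg : g ∈ H4a) :
    ∃ a ∈ tetraFour, ∃ i j : Fin 2, g = a * (swapFour ^ i.1 * (-1) ^ j.1) := by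
  have key := gl_four_decide (fun m => (m 0 0 * m 1 1 - m 0 1 * m 1 0 =
      if m.map (ZMod.castHom (by decide : 2 ∣ 4) (ZMod 2)) ≠ 1 ∧
      m.map (ZMod.castHom (by decide : 2 ∣ 4) (ZMod 2)) *
      m.map (ZMod.castHom (by decide : 2 ∣ 4) (ZMod 2)) = 1 then -1 else 1) →
    ∃ i j : Fin 2, m * ((-1) ^ j.1 * !![0, 1; 1, 0] ^ i.1) ∈ tetraList) (by decide +kernel) g
  have hg' : g.1 0 0 * g.1 1 1 - g.1 0 1 * g.1 1 0 =
      if (redFourTwo g).1 ≠ 1 ∧ (redFourTwo g).1 * (redFourTwo g).1 = 1 then -1 else 1 := by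
    have h := congrArg Units.val (mem_H4a.1 hg)
    rw [Matrix.GeneralLinearGroup.val_det_apply, Matrix.det_fin_two] at h
    rw [h]
    by_cases hc : (redFourTwo g).1 ≠ 1 ∧ (redFourTwo g).1 * (redFourTwo g).1 = 1
    · rw [if_pos hc, show epsilonGl (redFourTwo g) = -1 from if_pos hc]
      decide
    · rw [if_neg hc, show epsilonGl (redFourTwo g) = 1 from if_neg hc]
      decide
  obtain ⟨i, j, h⟩ := key hg'
  have hs : swapFour * swapFour = 1 := Units.ext (by decide)
  have hsi : ∀ i : Fin 2, swapFour ^ i.1 * swapFour ^ i.1 = 1 := by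
    intro i
    rw [← (Commute.refl swapFour).mul_pow, hs, one_pow]
  have hji : ∀ j : Fin 2, (-1 : Gl 4) ^ j.1 * (-1) ^ j.1 = 1 := by
    intro j
    rw [← (Commute.refl (-1 : Gl 4)).mul_pow, neg_one_mul, neg_neg, one_pow]
  refine ⟨g * ((-1) ^ j.1 * swapFour ^ i.1), ?_, i, j, ?_⟩
  · change (g * ((-1) ^ j.1 * swapFour ^ i.1)).1 ∈ tetraList
    simp only [Units.val_mul, Units.val_pow_eq_pow_val, Units.val_neg, Units.val_one]
    exact h
  · rw [mul_assoc, mul_assoc, ← mul_assoc (swapFour ^ i.1), hsi, one_mul, hji, mul_one]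

/-- Modulo the normal subgroup `tetraFour`, the group `H4a` is generated by `swapFour` and the
central element `-1`, hence abelian. -/
theorem commutator_H4a_le : ⁅H4a, H4a⁆ ≤ tetraFour := by
  rw [Subgroup.commutator_le]
  intro x hx y hy
  obtain ⟨a, ha, i, j, rfl⟩ := exists_eq_of_mem_H4a hx
  obtain ⟨b, hb, k, l, rfl⟩ := exists_eq_of_mem_H4a hy
  rw [← QuotientGroup.ker_mk' tetraFour, MonoidHom.mem_ker, map_commutatorElement,
    commutatorElement_eq_one_iff_commute, map_mul, map_mul _ b,
    (MonoidHom.mem_ker (f := QuotientGroup.mk' tetraFour)).1 (by rwa [QuotientGroup.ker_mk']),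
    (MonoidHom.mem_ker (f := QuotientGroup.mk' tetraFour) (x := b)).1
      (by rwa [QuotientGroup.ker_mk']), one_mul, one_mul]
  have hneg : ∀ (z : Gl 4) (n : ℕ), Commute z ((-1) ^ n) := by
    intro z n
    exact ((Commute.one_right z).neg_right).pow_right n
  refine Commute.map (Commute.mul_left (Commute.mul_right ?_ (hneg _ _))
    (Commute.mul_right (hneg _ _).symm (hneg _ _))) _
  exact (Commute.refl _).pow_pow _ _

theorem H4a_comap_mem_G36 : H4a.comap redFour ∈ G36 := by
  have hm : Units.map (Int.castRingHom (ZMod 4)).toMonoidHom (-1) = -1 := by decide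
  have hu : ∀ u : (ZMod 4)ˣ, u = 1 ∨ u = -1 := by decide
  have hS : epsilonGl involTwoS = -1 := by decide
  -- `H4a` is the kernel of a character and contains every commutator, so strictness needs an
  -- element outside `⁅H4a, H4a⁆`: the matrix `-1` is a commutator but is not in `tetraFour`.
  refine comap_redFour_mem_G36 _ (fun g => ?_) (fun u => ?_) ⟨-1, ?_, fun h => ?_⟩
  · obtain ⟨x, rfl, hx⟩ := exists_lift_four g
      (Units.map (Int.castRingHom (ZMod 4)).toMonoidHom (epsilonGl g))
    exact ⟨x, hx, rfl⟩
  · rcases hu u with rfl | rfl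
    · exact ⟨1, H4a.one_mem, map_one _⟩
    · obtain ⟨x, hx, hx'⟩ := exists_lift_four involTwoS (-1)
      exact ⟨x, by rw [mem_H4a, hx, hx', hS, hm], hx'⟩
  · have : (-1 : Gl 4) = swapFour * Gl.ofEntries 1 0 0 (-1) (-1) (by decide) * swapFour⁻¹ *
        (Gl.ofEntries 1 0 0 (-1) (-1) (by decide))⁻¹ := Units.ext (by decide +kernel)
    rw [this]
    exact mul_mem_commutator_top _ _
  · have : (-1 : Matrix (Fin 2) (Fin 2) (ZMod 4)) ∈ tetraList := commutator_H4a_le h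
    revert this
    decide +kernel

theorem kleinFour_not_mem_H4b : kleinFour ∉ H4b := by
  rw [H4b_eq]
  intro h
  have h' : kleinFour * cubeRootFour * kleinFour⁻¹ = cubeRootFour ∨
    kleinFour * cubeRootFour * kleinFour⁻¹ = cubeRootFour⁻¹ := h
  simp only [Units.ext_iff] at h'
  revert h'
  decide +kernel

theorem H4b_comap_mem_G36 : H4b.comap redFour ∈ G36 := by
  let a : Gl 4 := ⟨!![0, 1; 3, 0], !![0, 3; 1, 0], by decide, by decide⟩
  let b : Gl 4 := ⟨!![0, 1; 1, 1], !![3, 1; 1, 0], by decide, by decide⟩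
  have ha : a ∈ H4b := Subgroup.subset_closure (by simp [a])
  have hb : b ∈ H4b := Subgroup.subset_closure (by simp [b])
  refine comap_redFour_mem_G36 _ (fun g => ?_) (fun u => ?_) ⟨kleinFour, ?_,
    not_mem_commutator kleinFour_not_mem_H4b⟩
  · have key := gl_two_decide (fun m => ∃ (i : Fin 2) (j : Fin 3),
      !![0, 1; 1, 0] ^ i.1 * !![0, 1; 1, 1] ^ j.1 = m) (by decide +kernel) g
    obtain ⟨i, j, h⟩ := key
    refine ⟨a ^ i.1 * b ^ j.1, mul_mem (pow_mem ha _) (pow_mem hb _), Units.ext ?_⟩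
    have ra : (redFourTwo a).1 = !![0, 1; 1, 0] := by decide
    have rb : (redFourTwo b).1 = !![0, 1; 1, 1] := by decide
    rw [map_mul, map_pow, map_pow, Units.val_mul, Units.val_pow_eq_pow_val,
      Units.val_pow_eq_pow_val, ra, rb, h]
  · have hu : ∀ u : (ZMod 4)ˣ, u = 1 ∨ u = -1 := by decide
    rcases hu u with rfl | rfl
    · exact ⟨1, H4b.one_mem, map_one _⟩
    · exact ⟨b, hb, Units.ext (by
        rw [Matrix.GeneralLinearGroup.val_det_apply, Matrix.det_fin_two]
        decide)⟩
  · rw [← eq_commutator_kleinFour]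
    exact mul_mem_commutator_top _ _

theorem upperNine_not_mem_H9a : upperNine 1 ∉ H9a := by
  rw [H9a_eq]
  intro h
  have h' : (upperNine 1).1 * quatI.1 * (upperNine 1)⁻¹.1 ∈ quatList := h.1.1
  revert h'
  decide +kernel

theorem H9a_comap_mem_G36 : H9a.comap redNine ∈ G36 := by
  let C : Gl 9 := ⟨!![2, 0; 0, 2], !![5, 0; 0, 5], by decide, by decide⟩
  let D : Gl 9 := ⟨!![-1, 0; 0, 1], !![-1, 0; 0, 1], by decide, by decide⟩
  have hC : C ∈ H9a := Subgroup.subset_closure (by simp [C])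
  have hD : D ∈ H9a := Subgroup.subset_closure (by simp [D])
  refine comap_redNine_mem_G36 _ exists_mem_H9a (fun u => ?_) ⟨upperNine 1, ?_,
    not_mem_commutator upperNine_not_mem_H9a⟩
  · have h : ∀ u v : ZMod 9, u * v = 1 → ∃ (i : Fin 2) (j : Fin 3), (-1) ^ i.1 * 4 ^ j.1 = u := by
      decide
    obtain ⟨i, j, hij⟩ := h u (u⁻¹ : (ZMod 9)ˣ) u.mul_inv
    have dC : (Matrix.GeneralLinearGroup.det C : (ZMod 9)ˣ) = (4 : ZMod 9) := by
      rw [Matrix.GeneralLinearGroup.val_det_apply, Matrix.det_fin_two]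
      decide
    have dD : (Matrix.GeneralLinearGroup.det D : (ZMod 9)ˣ) = (-1 : ZMod 9) := by
      rw [Matrix.GeneralLinearGroup.val_det_apply, Matrix.det_fin_two]
      decide
    exact ⟨D ^ i.1 * C ^ j.1, mul_mem (pow_mem hD _) (pow_mem hC _), Units.ext (by
      rw [map_mul, map_pow, map_pow, Units.val_mul, Units.val_pow_eq_pow_val,
        Units.val_pow_eq_pow_val, dC, dD, hij])⟩
  · have : upperNine 1 = Gl.ofEntries 2 0 0 1 5 (by decide) * upperNine 1 *
        (Gl.ofEntries 2 0 0 1 5 (by decide))⁻¹ * (upperNine 1)⁻¹ := Units.ext (by decide +kernel)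
    rw [this]
    exact mul_mem_commutator_top _ _

theorem mem_H6a_comap {θ : Gl 3 →* Gl 2} {x : Gl 36} :
    x ∈ (H6a θ).comap (redGl (by decide : 6 ∣ 36)) ↔
      redFourTwo (redFour x) = θ (redNineThree (redNine x)) := by
  change redGl _ (redGl _ x) = θ (redGl _ (redGl _ x)) ↔ _
  rw [redGl_redGl _ _ (by decide : 2 ∣ 36), redGl_redGl _ _ (by decide : 3 ∣ 36),
    redGl_redGl _ _ (by decide : 2 ∣ 36), redGl_redGl _ _ (by decide : 3 ∣ 36)]

theorem H6a_comap_mem_G36 (θ : Gl 3 →* Gl 2) (hθ : Function.Surjective θ) :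
    (H6a θ).comap (redGl (by decide : 6 ∣ 36)) ∈ G36 := by
  have key : ∀ (g : Gl 9) (u : (ZMod 4)ˣ), ∃ x ∈ (H6a θ).comap (redGl (by decide : 6 ∣ 36)),
      redNine x = g ∧ Matrix.GeneralLinearGroup.det (redFour x) = u := by
    intro g u
    obtain ⟨y, hy, hy'⟩ := exists_lift_four (θ (redNineThree g)) u
    obtain ⟨x, rfl, rfl⟩ := exists_gl_thirtySix y g
    exact ⟨x, mem_H6a_comap.2 hy, rfl, hy'⟩
  refine mem_G36_iff.2 ⟨fun g => ?_, fun g => ?_, fun u => ?_, ?_⟩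
  · obtain ⟨g, rfl⟩ := hθ g
    obtain ⟨y, rfl⟩ := exists_lift_nine g
    obtain ⟨x, hx, rfl, -⟩ := key y 1
    exact ⟨x, hx, mem_H6a_comap.1 hx⟩
  · obtain ⟨y, rfl⟩ := exists_lift_nine g
    obtain ⟨x, hx, rfl, -⟩ := key y 1
    exact ⟨x, hx, rfl⟩
  · obtain ⟨y, hy⟩ := exists_det_nine (Units.map _ u)
    obtain ⟨x, hx, rfl, hx'⟩ := key y (Units.map _ u)
    exact ⟨x, hx, det_thirtySix_ext hx' hy⟩
  -- Two elements trivial modulo 9 whose reductions modulo 2 do not commute have a commutator that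
  -- violates the entanglement.
  · obtain ⟨a, ha, -⟩ := exists_lift_four involTwoS 1
    obtain ⟨b, hb, -⟩ := exists_lift_four involTwoT 1
    obtain ⟨x, hx, hx'⟩ := exists_gl_thirtySix a 1
    obtain ⟨y, hy, hy'⟩ := exists_gl_thirtySix b 1
    refine ⟨x * y * x⁻¹ * y⁻¹, mul_mem_commutator_top _ _, not_mem_commutator ?_⟩
    rw [mem_H6a_comap]
    simp only [map_mul, map_inv, hx, hx', hy, hy', ha, hb, map_one, inv_one, mul_one]
    intro h
    exact absurd (Units.ext_iff.1 h) (by decide +kernel)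

/-! ### Conjugacy classes of maximal members of `G36` -/

/-- `H` is contained in `K` up to conjugation. -/
def SubConj {G : Type*} [Group G] (H K : Subgroup G) : Prop :=
  ∃ g : G, ∀ h ∈ H, g * h * g⁻¹ ∈ K

theorem SubConj.trans {G : Type*} [Group G] {H K L : Subgroup G} (h : SubConj H K)
    (h' : SubConj K L) : SubConj H L := by
  obtain ⟨a, ha⟩ := h
  obtain ⟨b, hb⟩ := h'
  refine ⟨b * a, fun x hx => ?_⟩
  have : b * a * x * (b * a)⁻¹ = b * (a * x * a⁻¹) * b⁻¹ := by group
  rw [this]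
  exact hb _ (ha x hx)

theorem SubConj.of_le {G : Type*} [Group G] {H K : Subgroup G} (h : H ≤ K) : SubConj H K :=
  ⟨1, fun x hx => by simpa using h hx⟩

theorem AreConj.symm_subConj {G : Type*} [Group G] {H K : Subgroup G} (h : AreConj H K) :
    SubConj K H := by
  obtain ⟨g, rfl⟩ := h
  refine ⟨g⁻¹, ?_⟩
  rintro _ ⟨x, hx, rfl⟩
  simpa [mul_assoc] using hx

/-- In a finite group a subgroup is not conjugate into a smaller one. -/
theorem SubConj.not_lt {G : Type*} [Group G] [Finite G] {H K : Subgroup G} (h : SubConj H K) :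
    ¬ K < H := by
  obtain ⟨g, hg⟩ := h
  intro hlt
  have h1 : Nat.card H ≤ Nat.card K :=
    Nat.card_le_card_of_injective (fun x : H => (⟨g * x.1 * g⁻¹, hg _ x.2⟩ : K)) (by
      intro x y hxy
      apply Subtype.ext
      simpa using congrArg Subtype.val hxy)
  exact hlt.ne (Subgroup.eq_of_le_of_card_ge hlt.le h1)

theorem map_conj_mem_G36 {H : Subgroup (Gl 36)} (hH : H ∈ G36) (g : Gl 36) :
    H.map (MulAut.conj g).toMonoidHom ∈ G36 := by
  have hmap : ∀ {M : Type} [Group M] (f : Gl 36 →* M), (∀ u, ∃ x ∈ H, f x = u) →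
      ∀ u, ∃ x ∈ H.map (MulAut.conj g).toMonoidHom, f x = u := by
    intro M _ f hf u
    obtain ⟨j, hj, hj'⟩ := hf ((f g)⁻¹ * u * f g)
    exact ⟨_, ⟨j, hj, rfl⟩, by simp [hj', mul_assoc]⟩
  obtain ⟨h2, h3, hd, x, hx, hx'⟩ := mem_G36_iff.1 hH
  refine mem_G36_iff.2 ⟨hmap (redFourTwo.comp redFour) h2, hmap (redNineThree.comp redNine) h3,
    hmap _ hd, g * x * g⁻¹, Subgroup.Normal.conj_mem inferInstance _ hx g, fun h => hx' ?_⟩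
  rw [← Subgroup.map_commutator] at h
  obtain ⟨y, hy, hy'⟩ := h
  have : y = x := by simpa using hy'
  exact this ▸ hy

theorem ne_top_of_mem_G36 {H : Subgroup (Gl 36)} (hH : H ∈ G36) : H ≠ ⊤ := by
  rintro rfl
  obtain ⟨-, -, -, x, hx, hx'⟩ := mem_G36_iff.1 hH
  exact hx' hx

theorem subConj_comap_of_conj {G A : Type*} [Group G] [Group A] {n : G →* A}
    (hn : Function.Surjective n) {H : Subgroup G} {K : Subgroup A}
    (h : ∃ g, ∀ x ∈ H.map n, g * x * g⁻¹ ∈ K) :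
    SubConj H (K.comap n) := by
  obtain ⟨g, hg⟩ := h
  obtain ⟨g, rfl⟩ := hn g
  refine ⟨g, fun x hx => ?_⟩
  have := hg _ (Subgroup.mem_map_of_mem n hx)
  rwa [← map_inv, ← map_mul, ← map_mul] at this

/-- Every member of `G36` lies in a conjugate of one of the four subgroups. -/
theorem subConj_of_mem_G36 (θ : Gl 3 →* Gl 2) (hθ : IsTheta θ) {H : Subgroup (Gl 36)}
    (hH : H ∈ G36) : SubConj H (H4a.comap redFour) ∨ SubConj H (H4b.comap redFour) ∨
      SubConj H (H9a.comap redNine) ∨ SubConj H ((H6a θ).comap (redGl (by decide : 6 ∣ 36))) := by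
  obtain ⟨h2, h3, hd, x, hx, hx'⟩ := mem_G36_iff.1 hH
  by_cases h4 : H.map redFour = ⊤
  · by_cases h9 : H.map redNine = ⊤
    · right; right; right
      obtain ⟨s, hs⟩ := exists_conj_theta θ hθ H h4 h9 fun h => hx' (h hx)
      obtain ⟨y, rfl, -⟩ := exists_lift_four s 1
      obtain ⟨z, rfl, hz⟩ := exists_gl_thirtySix y 1
      refine ⟨z⁻¹, fun h hh => mem_H6a_comap.2 ?_⟩
      simp only [map_mul, map_inv, hz, hs h hh, inv_one, one_mul, mul_one]
      group
    · right; right; left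
      obtain ⟨g, hg⟩ := conj_le_H9a (H.map redNine) (by
        rw [eq_top_iff]
        intro g _
        obtain ⟨x, hx, rfl⟩ := h3 g
        exact ⟨_, ⟨x, hx, rfl⟩, rfl⟩) (by
        rw [eq_top_iff]
        intro u _
        have hu : ∀ u v : ZMod 9, u * v = 1 → ∃ x y : ZMod 36, x * y = 1 ∧
          ZMod.castHom (by decide : 9 ∣ 36) (ZMod 9) x = u := by decide +kernel
        obtain ⟨v, w, hvw, hv⟩ := hu u (u⁻¹ : (ZMod 9)ˣ) u.mul_inv
        obtain ⟨x, hx, hx'⟩ := hd ⟨v, w, hvw, by rw [mul_comm, hvw]⟩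
        refine ⟨_, ⟨x, hx, rfl⟩, Units.ext ?_⟩
        rw [det_redGl, hx', ← hv]) h9
      exact subConj_comap_of_conj redNine_surjective ⟨g, hg⟩
  · have := le_H4a_or_conj_le_H4b (H.map redFour) (by
      rw [eq_top_iff]
      intro g _
      obtain ⟨x, hx, rfl⟩ := h2 g
      exact ⟨_, ⟨x, hx, rfl⟩, rfl⟩) (by
      rw [eq_top_iff]
      intro u _
      have hu : ∀ u v : ZMod 4, u * v = 1 → ∃ x y : ZMod 36, x * y = 1 ∧
        ZMod.castHom (by decide : 4 ∣ 36) (ZMod 4) x = u := by decide +kernel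
      obtain ⟨v, w, hvw, hv⟩ := hu u (u⁻¹ : (ZMod 4)ˣ) u.mul_inv
      obtain ⟨x, hx, hx'⟩ := hd ⟨v, w, hvw, by rw [mul_comm, hvw]⟩
      refine ⟨_, ⟨x, hx, rfl⟩, Units.ext ?_⟩
      rw [det_redGl, hx', ← hv]) h4
    rcases this with h | h
    · exact Or.inl (SubConj.of_le (Subgroup.map_le_iff_le_comap.1 h))
    · exact Or.inr (Or.inl (subConj_comap_of_conj redFour_surjective h))

/-! ### The four subgroups are not conjugate into each other -/

/-- The kernels of reduction modulo 4 and modulo 6 generate the kernel modulo 2, so surjectivity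
modulo 2 forces `K = ⊤`. For 9 and 6 the same works modulo 3, and the kernels for 4 and 9 already
generate everything. -/
theorem not_mem_G36_of_four_six {K : Subgroup (Gl 36)} (h4 : redFour.ker ≤ K)
    (h6 : (redFourTwo.comp redFour).ker ⊓ (redNineThree.comp redNine).ker ≤ K) : K ∉ G36 := by
  intro hK
  apply ne_top_of_mem_G36 hK
  obtain ⟨h2, -⟩ := mem_G36_iff.1 hK
  rw [eq_top_iff]
  intro x _
  obtain ⟨y, hy, hy'⟩ := h2 (redFourTwo (redFour x))
  obtain ⟨a, ha, ha'⟩ := exists_gl_thirtySix (redFour (x * y⁻¹)) 1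
  have haK : a ∈ K := h6 ⟨by simp [ha, hy'], by simp [ha']⟩
  have hbK : a⁻¹ * (x * y⁻¹) ∈ K := h4 (by rw [MonoidHom.mem_ker, map_mul, map_inv, ha,
    inv_mul_cancel])
  have := K.mul_mem (K.mul_mem haK hbK) hy
  simpa using this

theorem not_mem_G36_of_nine_six {K : Subgroup (Gl 36)} (h9 : redNine.ker ≤ K)
    (h6 : (redFourTwo.comp redFour).ker ⊓ (redNineThree.comp redNine).ker ≤ K) : K ∉ G36 := by
  intro hK
  apply ne_top_of_mem_G36 hK
  obtain ⟨-, h3, -⟩ := mem_G36_iff.1 hK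
  rw [eq_top_iff]
  intro x _
  obtain ⟨y, hy, hy'⟩ := h3 (redNineThree (redNine x))
  obtain ⟨a, ha, ha'⟩ := exists_gl_thirtySix 1 (redNine (x * y⁻¹))
  have haK : a ∈ K := h6 ⟨by simp [ha], by simp [ha', hy']⟩
  have hbK : a⁻¹ * (x * y⁻¹) ∈ K := h9 (by rw [MonoidHom.mem_ker, map_mul, map_inv, ha',
    inv_mul_cancel])
  have := K.mul_mem (K.mul_mem haK hbK) hy
  simpa using this

theorem not_mem_G36_of_four_nine {K : Subgroup (Gl 36)} (h4 : redFour.ker ≤ K)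
    (h9 : redNine.ker ≤ K) : K ∉ G36 := by
  intro hK
  apply ne_top_of_mem_G36 hK
  rw [eq_top_iff]
  intro x _
  obtain ⟨a, ha, ha'⟩ := exists_gl_thirtySix (redFour x) 1
  have hbK : a⁻¹ * x ∈ K := h4 (by rw [MonoidHom.mem_ker, map_mul, map_inv, ha, inv_mul_cancel])
  have := K.mul_mem (h9 ha' : a ∈ K) hbK
  simpa using this

/-- A normal subgroup contained in `H` is contained in every subgroup into which `H` is
conjugate. -/
theorem SubConj.normal_le {G : Type*} [Group G] {H K N : Subgroup G} [hN : N.Normal]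
    (h : SubConj H K) (hH : N ≤ H) : N ≤ K := by
  obtain ⟨g, hg⟩ := h
  intro x hx
  have := hg _ (hH (hN.conj_mem x hx g⁻¹))
  simpa [mul_assoc] using this

theorem ker_le_comap {G A : Type*} [Group G] [Group A] (p : G →* A) (K : Subgroup A) :
    p.ker ≤ K.comap p := by
  intro x hx
  rw [Subgroup.mem_comap, MonoidHom.mem_ker.1 hx]
  exact K.one_mem

theorem ker_le_H6a_comap (θ : Gl 3 →* Gl 2) :
    (redFourTwo.comp redFour).ker ⊓ (redNineThree.comp redNine).ker ≤
      (H6a θ).comap (redGl (by decide : 6 ∣ 36)) := by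
  rintro x ⟨h2, h3⟩
  have h2' : redFourTwo (redFour x) = 1 := h2
  have h3' : redNineThree (redNine x) = 1 := h3
  rw [mem_H6a_comap, h2', h3', map_one]

theorem not_subConj_H4a_H4b : ¬ SubConj (H4a.comap redFour) (H4b.comap redFour) := by
  intro h
  have hk : kleinFour ∈ H4a := by
    rw [mem_H4a]
    apply Units.ext
    rw [Matrix.GeneralLinearGroup.val_det_apply, Matrix.det_fin_two]
    decide +kernel
  obtain ⟨x, hx⟩ := redFour_surjective kleinFour
  apply kleinFour_not_mem_H4b
  rw [← hx] at hk ⊢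
  exact h.normal_le le_rfl (show x ∈ H4a.comap redFour from hk)

/-- Since `H4a` is normal, containment up to conjugacy would be containment; but the first generator
of `H4b` has determinant `1` and is an involution modulo 2. -/
theorem not_subConj_H4b_H4a : ¬ SubConj (H4b.comap redFour) (H4a.comap redFour) := by
  rintro ⟨g, hg⟩
  let a : Gl 4 := ⟨!![0, 1; 3, 0], !![0, 3; 1, 0], by decide, by decide⟩
  have ha : a ∈ H4b := Subgroup.subset_closure (by simp [a])
  obtain ⟨x, hx⟩ := redFour_surjective a
  have h1 := hg x (by rw [Subgroup.mem_comap, hx]; exact ha)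
  have h2 : x ∈ H4a.comap redFour := by
    have := Subgroup.Normal.conj_mem (inferInstance : (H4a.comap redFour).Normal) _ h1 g⁻¹
    simpa [mul_assoc] using this
  rw [Subgroup.mem_comap, hx, mem_H4a] at h2
  have h3 := congrArg Units.val h2
  rw [Matrix.GeneralLinearGroup.val_det_apply, Matrix.det_fin_two] at h3
  revert h3
  decide +kernel

/-- The four maximal subgroups. -/
def fourSubgroups (θ : Gl 3 →* Gl 2) : Fin 4 → Subgroup (Gl 36) :=
  ![H4a.comap redFour, H4b.comap redFour, H9a.comap redNine,
    (H6a θ).comap (redGl (by decide : 6 ∣ 36))]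

theorem fourSubgroups_mem (θ : Gl 3 →* Gl 2) (hθ : IsTheta θ) (i : Fin 4) :
    fourSubgroups θ i ∈ G36 := by
  fin_cases i
  · exact H4a_comap_mem_G36
  · exact H4b_comap_mem_G36
  · exact H9a_comap_mem_G36
  · exact H6a_comap_mem_G36 θ hθ.1

theorem eq_of_subConj (θ : Gl 3 →* Gl 2) (hθ : IsTheta θ) (i j : Fin 4)
    (h : SubConj (fourSubgroups θ i) (fourSubgroups θ j)) : i = j := by
  have h4a : redFour.ker ≤ H4a.comap redFour := ker_le_comap _ _
  have h4b : redFour.ker ≤ H4b.comap redFour := ker_le_comap _ _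
  have h9 : redNine.ker ≤ H9a.comap redNine := ker_le_comap _ _
  have h6 := ker_le_H6a_comap θ
  have hj := fourSubgroups_mem θ hθ j
  fin_cases i <;> fin_cases j
  · rfl
  · exact absurd h not_subConj_H4a_H4b
  · exact absurd hj (not_mem_G36_of_four_nine (h.normal_le h4a) h9)
  · exact absurd hj (not_mem_G36_of_four_six (h.normal_le h4a) h6)
  · exact absurd h not_subConj_H4b_H4a
  · rfl
  · exact absurd hj (not_mem_G36_of_four_nine (h.normal_le h4b) h9)
  · exact absurd hj (not_mem_G36_of_four_six (h.normal_le h4b) h6)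
  · exact absurd hj (not_mem_G36_of_four_nine h4a (h.normal_le h9))
  · exact absurd hj (not_mem_G36_of_four_nine h4b (h.normal_le h9))
  · rfl
  · exact absurd hj (not_mem_G36_of_nine_six (h.normal_le h9) h6)
  · exact absurd hj (not_mem_G36_of_four_six h4a (h.normal_le h6))
  · exact absurd hj (not_mem_G36_of_four_six h4b (h.normal_le h6))
  · exact absurd hj (not_mem_G36_of_nine_six h9 (h.normal_le h6))
  · rfl

theorem exists_subConj_fourSubgroups (θ : Gl 3 →* Gl 2) (hθ : IsTheta θ) {H : Subgroup (Gl 36)}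
    (hH : H ∈ G36) : ∃ i, SubConj H (fourSubgroups θ i) := by
  rcases subConj_of_mem_G36 θ hθ hH with h | h | h | h
  exacts [⟨0, h⟩, ⟨1, h⟩, ⟨2, h⟩, ⟨3, h⟩]

theorem isConjRepresentatives_fourSubgroups (θ : Gl 3 →* Gl 2) (hθ : IsTheta θ) :
    IsConjRepresentatives (Set.range (fourSubgroups θ)) G36max := by
  constructor
  · rintro _ ⟨i, rfl⟩
    refine ⟨fourSubgroups_mem θ hθ i, ?_⟩
    rintro ⟨H, hH, hlt, -⟩
    obtain ⟨j, hj⟩ := exists_subConj_fourSubgroups θ hθ hH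
    -- A larger member `H` would be conjugate into the same subgroup, hence into a proper subgroup
    -- of itself, which cardinality excludes.
    obtain rfl := eq_of_subConj θ hθ i j ((SubConj.of_le hlt.le).trans hj)
    exact hj.not_lt hlt
  · rintro H ⟨hH, hmax⟩
    obtain ⟨i, g, hg⟩ := exists_subConj_fourSubgroups θ hθ hH
    have hK := map_conj_mem_G36 (fourSubgroups_mem θ hθ i) g⁻¹
    have hle : H ≤ (fourSubgroups θ i).map (MulAut.conj g⁻¹).toMonoidHom :=
      fun x hx => ⟨_, hg x hx, by simp [mul_assoc]⟩
    have heq := hle.eq_or_lt.resolve_right fun hlt =>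
      hmax ⟨_, hK, hlt, lt_top_iff_ne_top.2 (ne_top_of_mem_G36 hK)⟩
    refine ⟨fourSubgroups θ i, ⟨⟨i, rfl⟩, g, ?_⟩, ?_⟩
    · rw [heq, Subgroup.map_map]
      ext x
      simp [mul_assoc]
    · rintro _ ⟨⟨j, rfl⟩, hj⟩
      have hi : SubConj H (fourSubgroups θ i) := ⟨g, hg⟩
      rw [eq_of_subConj θ hθ j i (hj.symm_subConj.trans hi)]

theorem range_fourSubgroups (θ : Gl 3 →* Gl 2) : Set.range (fourSubgroups θ) =
    {H4a.comap (redGl (by decide : 4 ∣ 36)), H4b.comap (redGl (by decide : 4 ∣ 36)),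
      H9a.comap (redGl (by decide : 9 ∣ 36)), (H6a θ).comap (redGl (by decide : 6 ∣ 36))} := by
  ext H
  simp only [fourSubgroups, Matrix.range_cons, Matrix.range_empty, Set.union_empty,
    Set.singleton_union]

theorem proposition2p3 (θ : Gl 3 →* Gl 2) (hθ : IsTheta θ) :
    IsConjRepresentatives
        ({H4a.comap (redGl (by decide : 4 ∣ 36)), H4b.comap (redGl (by decide : 4 ∣ 36)),
          H9a.comap (redGl (by decide : 9 ∣ 36)), (H6a θ).comap (redGl (by decide : 6 ∣ 36))} :
          Set (Subgroup (Gl 36)))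
        G36max ∧
      ({H4a.comap (redGl (by decide : 4 ∣ 36)), H4b.comap (redGl (by decide : 4 ∣ 36)),
          H9a.comap (redGl (by decide : 9 ∣ 36)), (H6a θ).comap (redGl (by decide : 6 ∣ 36))} :
          Set (Subgroup (Gl 36))).ncard = 4 := by
  rw [← range_fourSubgroups]
  refine ⟨isConjRepresentatives_fourSubgroups θ hθ, ?_⟩
  have hinj : Function.Injective (fourSubgroups θ) := fun i j h =>
    eq_of_subConj θ hθ i j (SubConj.of_le h.le)
  rw [← Set.image_univ, Set.ncard_image_of_injective _ hinj, Set.ncard_univ, Nat.card_fin]
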